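/- Let $n,d\ge 0$ be integers. For a commutative ring $R$ put $V_R=R^n$ and let $S_R(n,d)=\operatorname{End}_{\Sigma_d}(V_R^{\otimes d})$ be the algebra of $R$-linear endomorphisms of $V_R^{\otimes d}$ that commute with all permutations of the tensor places. Write $S(n,d)=S_{\mathbb Q}(n,d)$, $V=V_{\mathbb Q}$, and regard $S_{\mathbb Z}(n,d)$ as a subring of $S(n,d)$ by extension of scalars from $\mathbb Z$ to $\mathbb Q$. A matrix $X\in\mathfrak{gl}_n(\mathbb Q)$ acts on $V^{\otimes d}$ by $\sum_{k=1}^d 1\otimes\cdots\otimes X\otimes\cdots\otimes 1$ ($X$ in place $k$), which is an element of $S(n,d)$; let $e_i,f_i$ $(1\le i\le n-1)$ and $H_i$ $(1\le i\le n)$ be the elements of $S(n,d)$ given in this way by the matrix units $E_{i,i+1}$, $E_{i+1,i}$ and $E_{ii}$. Let $\Phi^+=\{\varepsilon_i-\varepsilon_j\mid 1\le i<j\le n\}$, $\alpha_i=\varepsilon_i-\varepsilon_{i+1}$. For $\alpha=\varepsilon_i-\varepsilon_j\in\Phi^+$ define $x_{\pm\alpha}\in S(n,d)$ inductively by $x_{\alpha}=e_i$,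 $x_{-\alpha}=f_i$ if $j=i+1$, and $x_\alpha=e_ix_{\alpha-\alpha_i}-x_{\alpha-\alpha_i}e_i$, $x_{-\alpha}=x_{-\alpha+\alpha_i}f_i-f_ix_{-\alpha+\alpha_i}$ if $j>i+1$. Put $x^{(m)}=x^m/m!$ and $\binom{H_i}{m}=H_i(H_i-1)\cdots(H_i-m+1)/m!$. Fix two arbitrary total orders on $\Phi^+$, and for $A,C\in\mathbb N^{\Phi^+}$ put $e_A=\prod_{\alpha\in\Phi^+}x_\alpha^{(A(\alpha))}$ (product in the first order) and $f_C=\prod_{\alpha\in\Phi^+}x_{-\alpha}^{(C(\alpha))}$ (product in the second order). Let $\Lambda(n,d)=\{\lambda\in\mathbb N^n\mid\sum_i\lambda_i=d\}$ and, for $\lambda\in\Lambda(n,d)$, put $1_\lambda=\prod_{i=1}^n\binom{H_i}{\lambda_i}$. On formal products of factors $x_{\varepsilon_i-\varepsilon_j}^{(m)}$ ($i\ne j$) and $\binom{H_i}{m}$ define two functions $\chi,\chi'$ with values in $\mathbb N^n$, which turn products into sums, by $\chi(x_{\varepsilon_i-\varepsilon_j}^{(m)})=m\,\varepsilon_{\max(i,j)}$,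 $\chi'(x_{\varepsilon_i-\varepsilon_j}^{(m)})=m\,\varepsilon_{\min(i,j)}$ and $\chi(\binom{H_i}{m})=\chi'(\binom{H_i}{m})=0$. Let $\preceq$ be the componentwise order on $\mathbb N^n$. **Theorem.** The integral Schur algebra $S_{\mathbb Z}(n,d)$ is the subring of $S(n,d)$ generated by all divided powers $e_i^{(m)}$, $f_i^{(m)}$ ($1\le i\le n-1$, $m\ge 0$). Moreover, each of the sets $$Y_+=\bigcup_{\lambda\in\Lambda(n,d)}\{e_A1_\lambda f_C\mid A,C\in\mathbb N^{\Phi^+},\ \chi(e_Af_C)\preceq\lambda\},\qquad Y_-=\bigcup_{\lambda\in\Lambda(n,d)}\{f_A1_\lambda e_C\mid A,C\in\mathbb N^{\Phi^+},\ \chi'(f_Ae_C)\preceq\lambda\}$$ is a $\mathbb Z$-basis of $S_{\mathbb Z}(n,d)$. The unions are disjoint; more precisely, in each of $Y_+$ and $Y_-$ different triples $(\lambda,A,C)$ satisfying the condition give different elements. -/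

import Mathlib

open scoped TensorProduct

noncomputable section

namespace SchurAlg

/-! ### Schur algebras as commuting algebras -/

/-- The tensor power `V_R^{⊗ d}` of the free module `V_R = R^n`. -/
def TensorSpace (R : Type) [CommRing R] (n d : ℕ) : Type := ⨂[R]^d (Fin n → R)

instance (R : Type) [CommRing R] (n d : ℕ) : AddCommGroup (TensorSpace R n d) :=
  inferInstanceAs (AddCommGroup (⨂[R]^d (Fin n → R)))

instance (R : Type) [CommRing R] (n d : ℕ) : Module R (TensorSpace R n d) :=
  inferInstanceAs (Module R (⨂[R]^d (Fin n → R)))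

/-- The identity map from the tensor power to `TensorSpace`. -/
def toTensorSpace (R : Type) [CommRing R] (n d : ℕ) :
    (⨂[R]^d (Fin n → R)) ≃ₗ[R] TensorSpace R n d where
  toFun x := x
  invFun x := x
  map_add' _ _ := rfl
  map_smul' _ _ := rfl
  left_inv _ := rfl
  right_inv _ := rfl

/-- The permutation of the tensor places by `σ`. -/
def permAction (R : Type) [CommRing R] (n d : ℕ) (σ : Equiv.Perm (Fin d)) :
    Module.End R (TensorSpace R n d) :=
  (toTensorSpace R n d).conj
    (PiTensorProduct.reindex R (fun _ : Fin d => (Fin n → R)) σ).toLinearMap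

/-- `S_R(n,d) = End_{Σ_d}(V_R^{⊗ d})`: the `R`-linear endomorphisms of the `d`-th tensor power
that commute with all permutations of the tensor places. -/
def schurAlgebra (R : Type) [CommRing R] (n d : ℕ) :
    Subalgebra R (Module.End R (TensorSpace R n d)) :=
  Subalgebra.centralizer R (Set.range (permAction R n d))

/-- The inclusion `ℤ^n → ℚ^n`. -/
def vecCast (n : ℕ) : (Fin n → ℤ) →ₗ[ℤ] (Fin n → ℚ) where
  toFun v i := (v i : ℚ)
  map_add' v w := by ext i; simp
  map_smul' c v := by ext i; simp

/-- The canonical map `V_ℤ^{⊗ d} → V_ℚ^{⊗ d}`, `v₁ ⊗ ⋯ ⊗ v_d ↦ v₁ ⊗ ⋯ ⊗ v_d`. -/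
def tensorCast (n d : ℕ) : TensorSpace ℤ n d →ₗ[ℤ] TensorSpace ℚ n d :=
  (PiTensorProduct.lift
    ((((toTensorSpace ℚ n d).toLinearMap.compMultilinearMap
      (PiTensorProduct.tprod ℚ)).restrictScalars ℤ).compLinearMap fun _ => vecCast n)) ∘ₗ
    (toTensorSpace ℤ n d).symm.toLinearMap

/-- The integral Schur algebra `S_ℤ(n,d) = End_{Σ_d}(V_ℤ^{⊗ d})`, viewed as a subring of
`S(n,d) = S_ℚ(n,d)` through extension of scalars: it consists of the `F` in `S(n,d)` that extend
some `f` in `schurAlgebra ℤ n d`. -/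
def integralSchur (n d : ℕ) : Subring (schurAlgebra ℚ n d) where
  carrier := {F | ∃ f ∈ schurAlgebra ℤ n d, ∀ t, F.1 (tensorCast n d t) = tensorCast n d (f t)}
  mul_mem' := by
    rintro F G ⟨f, hf, hF⟩ ⟨g, hg, hG⟩
    refine ⟨f * g, mul_mem hf hg, fun t => ?_⟩
    simp [hF, hG]
  one_mem' := ⟨1, one_mem _, fun t => by simp⟩
  add_mem' := by
    rintro F G ⟨f, hf, hF⟩ ⟨g, hg, hG⟩
    refine ⟨f + g, add_mem hf hg, fun t => ?_⟩
    simp [hF, hG]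
  zero_mem' := ⟨0, zero_mem _, fun t => by simp⟩
  neg_mem' := by
    rintro F ⟨f, hf, hF⟩
    refine ⟨-f, neg_mem hf, fun t => ?_⟩
    simp [hF]

/-! ### The action of `𝔤𝔩_n` on tensor space -/

/-- The operator `∑ k, 1 ⊗ ⋯ ⊗ X ⊗ ⋯ ⊗ 1` (with `X` in place `k`) on `V^{⊗ d}`: the derivative
of the natural action of `GL(V)`. -/
def derivAction (n d : ℕ) (X : Matrix (Fin n) (Fin n) ℚ) : Module.End ℚ (TensorSpace ℚ n d) :=
  (toTensorSpace ℚ n d).conj (∑ k : Fin d, PiTensorProduct.map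
    (Function.update (fun _ : Fin d => (LinearMap.id : (Fin n → ℚ) →ₗ[ℚ] (Fin n → ℚ))) k
      (Matrix.toLin' X)))

theorem derivAction_mem (n d : ℕ) (X : Matrix (Fin n) (Fin n) ℚ) :
    derivAction n d X ∈ schurAlgebra ℚ n d := by
  rw [schurAlgebra, Subalgebra.mem_centralizer_iff]
  rintro _ ⟨σ, rfl⟩
  rw [permAction, derivAction, Module.End.mul_eq_comp, Module.End.mul_eq_comp,
    ← LinearEquiv.conj_comp, ← LinearEquiv.conj_comp]
  congr 1
  refine PiTensorProduct.ext (MultilinearMap.ext fun v => ?_)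
  simp only [LinearMap.compMultilinearMap_apply, LinearMap.comp_apply,
    LinearMap.sum_apply, map_sum, PiTensorProduct.map_tprod, LinearEquiv.coe_coe,
    PiTensorProduct.reindex_tprod]
  refine Fintype.sum_equiv σ _ _ fun k => ?_
  congr 1
  funext i
  by_cases h : i = σ k
  · subst h
    simp
  · have h' : σ.symm i ≠ k := fun hk => h (by rw [← hk]; simp)
    rw [Function.update_of_ne h, Function.update_of_ne h']

/-- The image in `S(n,d)` of the matrix unit `E_{ij}` of `𝔤𝔩_n`. -/
def unitAction (n d : ℕ) (i j : Fin n) : schurAlgebra ℚ n d :=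
  ⟨derivAction n d (Matrix.single i j 1), derivAction_mem n d _⟩

/-- The generator `e_i` (indices are shifted to `0 ≤ i < n - 1`). -/
def e (n d : ℕ) (i : Fin (n - 1)) : schurAlgebra ℚ n d :=
  unitAction n d ⟨i, by omega⟩ ⟨i + 1, by omega⟩

/-- The generator `f_i` (indices are shifted to `0 ≤ i < n - 1`). -/
def f (n d : ℕ) (i : Fin (n - 1)) : schurAlgebra ℚ n d :=
  unitAction n d ⟨i + 1, by omega⟩ ⟨i, by omega⟩

/-- The generator `H_i` (indices are shifted to `0 ≤ i < n`). -/
def H (n d : ℕ) (i : Fin n) : schurAlgebra ℚ n d := unitAction n d i i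

/-- `x_α` for the positive root `α = ε_i - ε_{i+k+1}`. -/
def posRootVector (n d : ℕ) : (k i : ℕ) → i + k + 1 < n → schurAlgebra ℚ n d
  | 0, i, h => e n d ⟨i, by omega⟩
  | k + 1, i, h =>
      e n d ⟨i, by omega⟩ * posRootVector n d k (i + 1) (by omega)
        - posRootVector n d k (i + 1) (by omega) * e n d ⟨i, by omega⟩

/-- `x_{-α}` for the positive root `α = ε_i - ε_{i+k+1}`. -/
def negRootVector (n d : ℕ) : (k i : ℕ) → i + k + 1 < n → schurAlgebra ℚ n d
  | 0, i, h => f n d ⟨i, by omega⟩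
  | k + 1, i, h =>
      negRootVector n d k (i + 1) (by omega) * f n d ⟨i, by omega⟩
        - f n d ⟨i, by omega⟩ * negRootVector n d k (i + 1) (by omega)

/-- The root vector `x_α`, `α = ε_i - ε_j` with `i ≠ j`. -/
def rootVector (n d : ℕ) (i j : Fin n) (hij : i ≠ j) : schurAlgebra ℚ n d :=
  if h : i < j then posRootVector n d (j - i - 1) i (by have := Fin.lt_def.1 h; omega)
  else negRootVector n d (i - j - 1) j (by have := Fin.val_ne_of_ne hij; omega)

/-- The divided power `x^{(m)} = x^m / m!`. -/
def dividedPower {n d : ℕ} (x : schurAlgebra ℚ n d) (m : ℕ) : schurAlgebra ℚ n d :=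
  ((m.factorial : ℚ)⁻¹) • x ^ m

/-- `binom(x, m) = x (x - 1) ⋯ (x - m + 1) / m!`. -/
def binom {n d : ℕ} (x : schurAlgebra ℚ n d) (m : ℕ) : schurAlgebra ℚ n d :=
  ((m.factorial : ℚ)⁻¹) • ((List.range m).map fun k => x - (k : schurAlgebra ℚ n d)).prod

/-! ### Kostant monomials and their content -/

/-- The formal factors of Kostant monomials: `root i j _ m` stands for `x_α^{(m)}` with
`α = ε_i - ε_j`, and `cartan i m` stands for `binom(H_i, m)`. -/
inductive KostantFactor (n : ℕ) : Type
  | root (i j : Fin n) (hij : i ≠ j) (m : ℕ) : KostantFactor n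
  | cartan (i : Fin n) (m : ℕ) : KostantFactor n

/-- A Kostant monomial, as a formal word. -/
abbrev KostantMonomial (n : ℕ) : Type := List (KostantFactor n)

namespace KostantFactor

/-- The element of `S(n,d)` denoted by a factor. -/
def eval {n : ℕ} (d : ℕ) : KostantFactor n → schurAlgebra ℚ n d
  | root i j hij m => dividedPower (rootVector n d i j hij) m
  | cartan i m => binom (H n d i) m

/-- The content of a factor: `m ε_{max(i,j)}` for `x_{ε_i - ε_j}^{(m)}`, and `0` for `binom(H_i, m)`. -/
def content {n : ℕ} : KostantFactor n → (Fin n → ℕ)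
  | root i j _ m => Pi.single (max i j) m
  | cartan _ _ => 0

/-- The mirror image of the content: `m ε_{min(i,j)}` for `x_{ε_i - ε_j}^{(m)}`, and `0` for
`binom(H_i, m)`. -/
def mirrorContent {n : ℕ} : KostantFactor n → (Fin n → ℕ)
  | root i j _ m => Pi.single (min i j) m
  | cartan _ _ => 0

end KostantFactor

namespace KostantMonomial

/-- The element of `S(n,d)` denoted by a Kostant monomial. -/
def eval {n : ℕ} (d : ℕ) (M : KostantMonomial n) : schurAlgebra ℚ n d :=
  (M.map (KostantFactor.eval d)).prod

/-- The content `χ(M)` of a Kostant monomial. -/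
def content {n : ℕ} (M : KostantMonomial n) : Fin n → ℕ :=
  (M.map KostantFactor.content).sum

/-- The mirror content `χ'(M)` of a Kostant monomial. -/
def mirrorContent {n : ℕ} (M : KostantMonomial n) : Fin n → ℕ :=
  (M.map KostantFactor.mirrorContent).sum

end KostantMonomial

/-- The positive roots; the pair `(i, j)` with `i < j` stands for `ε_i - ε_j`. -/
abbrev PosRoot (n : ℕ) : Type := {p : Fin n × Fin n // p.1 < p.2}

/-- `e_A = ∏ x_α^{(A(α))}` over the positive roots, in the order given by the list `l`. -/
def eMonomial {n : ℕ} (l : List (PosRoot n)) (A : PosRoot n → ℕ) : KostantMonomial n :=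
  l.map fun α => KostantFactor.root α.1.1 α.1.2 α.2.ne (A α)

/-- `f_C = ∏ x_{-α}^{(C(α))}` over the positive roots `α`, in the order given by the list `l`. -/
def fMonomial {n : ℕ} (l : List (PosRoot n)) (C : PosRoot n → ℕ) : KostantMonomial n :=
  l.map fun α => KostantFactor.root α.1.2 α.1.1 α.2.ne' (C α)

/-- `Λ(n,d)`: the `n`-part compositions of `d`. -/
abbrev Comp (n d : ℕ) : Type := {l : Fin n → ℕ // ∑ i, l i = d}

/-- `1_λ = ∏ i, binom(H_i, λ_i)`. -/
def idemMonomial {n : ℕ} (l : Fin n → ℕ) : KostantMonomial n :=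
  List.ofFn fun i => KostantFactor.cartan i (l i)

/-- The index set of `Y_+`: triples `(λ, A, C)` with `χ(e_A f_C) ⪯ λ`. -/
def IndexPlus (n d : ℕ) (le lf : List (PosRoot n)) : Type :=
  {p : Comp n d × (PosRoot n → ℕ) × (PosRoot n → ℕ) //
    KostantMonomial.content (eMonomial le p.2.1 ++ fMonomial lf p.2.2) ≤ p.1.1}

/-- The family `e_A 1_λ f_C` whose members form `Y_+`. -/
def yPlus (n d : ℕ) (le lf : List (PosRoot n)) (p : IndexPlus n d le lf) : schurAlgebra ℚ n d :=
  KostantMonomial.eval d (eMonomial le p.1.2.1 ++ idemMonomial p.1.1.1 ++ fMonomial lf p.1.2.2)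

/-- The index set of `Y_-`: triples `(λ, A, C)` with `χ'(f_A e_C) ⪯ λ`. -/
def IndexMinus (n d : ℕ) (le lf : List (PosRoot n)) : Type :=
  {p : Comp n d × (PosRoot n → ℕ) × (PosRoot n → ℕ) //
    KostantMonomial.mirrorContent (fMonomial lf p.2.1 ++ eMonomial le p.2.2) ≤ p.1.1}

/-- The family `f_A 1_λ e_C` whose members form `Y_-`. -/
def yMinus (n d : ℕ) (le lf : List (PosRoot n)) (p : IndexMinus n d le lf) : schurAlgebra ℚ n d :=
  KostantMonomial.eval d (fMonomial lf p.1.2.1 ++ idemMonomial p.1.1.1 ++ eMonomial le p.1.2.2)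

end SchurAlg

end

/-!
The tensor power `V^{⊗ d}` has a basis indexed by the words `w` of length `d` in `n` letters, and
`S(n,d)` is identified with the algebra of matrices, indexed by pairs of words, that are invariant
under simultaneous permutation of the places (`mem_schurAlgebra_iff`). The integral Schur algebra
consists of the invariant matrices with integral entries (`mem_integralSchur_iff`). The divided
power `x_{ε_a - ε_b}^{(m)}` is a matrix of zeros and ones: its entry at `(i, j)` is `1` if `i` is
obtained from `j` by changing exactly `m` letters `b` to `a` (`toWordMatrix_dividedPower`). The
element `1_λ` is the projection onto the words of weight `λ` (`toWordMatrix_idemMonomial`).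

*Bases.* By the triangle inequality for the Hamming distance, the entry of `e_A 1_λ f_C` at `(i, j)`
vanishes if `i` and `j` differ in more than `|A| + |C|` places. If they differ in exactly
`|A| + |C|` places, then every place changes at most once, so the intermediate word is forced: its
letters are the maxima of those of `i` and `j`, or the minima for `f_A 1_λ e_C`. Hence such an
entry is `1` or `0` according to whether the numbers of occurrences of the pairs of distinct
letters `(a, b)` in `(i, j)` are given by `A` and `C` and the intermediate word has weight `λ`
(`Leading.mul_diagonal_mul`). These data determine the orbit of `(i, j)` under permutations of the
places, and they come from some pair of words exactly if the content is bounded by `λ`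
(`exists_perm_of_pairType_eq`, `exists_pairType_eq`). So the family is unitriangular with respect to
the orbits of pairs of words, ordered by the Hamming distance, and is a `ℤ`-basis
(`exists_basis_of_unitriangular`).

*Generation.* Divided powers have integral matrices, and it remains to obtain the basis elements
from the simple root vectors. The `d`-th tensor power of the transvection `1 + s E_{ab}` is the
generating function `∑ s^m x_{ε_a - ε_b}^{(m)}`. Comparing coefficients in the commutator formula for
transvections over Laurent polynomials yields the divided powers of all root vectors
(`moveMatrix_mem_trans`). A torus element with entries `s` and `s⁻¹` at `a` and `b` is a product of
transvections as well, and the coefficient of `s^c` in its tensor power is the projection onto the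
weights `λ` with `λ_a - λ_b = c` (`diagonal_weight_sub_mem`). Since the coordinates of a weight have
the sum `d`, products of these projections give all `1_λ` (`weightMatrix_mem`).
-/

open scoped TensorProduct

noncomputable section

namespace SchurAlg

variable {n d : ℕ}

/-! ### Schur algebras as algebras of invariant matrices -/

/-- Words of length `d` in `n` letters, the index set of the standard basis of `V^{⊗ d}`. -/
abbrev Word (n d : ℕ) : Type := Fin d → Fin n

/-- The standard basis `v_{w₁} ⊗ ⋯ ⊗ v_{w_d}` of tensor space. -/
def wordBasis (R : Type) [CommRing R] (n d : ℕ) :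
    Module.Basis (Word n d) R (TensorSpace R n d) :=
  (Basis.piTensorProduct fun _ : Fin d => Pi.basisFun R (Fin n)).map (toTensorSpace R n d)

theorem wordBasis_apply (R : Type) [CommRing R] (w : Word n d) :
    wordBasis R n d w =
      toTensorSpace R n d (PiTensorProduct.tprod R fun r => Pi.single (w r) (1 : R)) := by
  simp [wordBasis]

theorem wordBasis_repr_tprod (R : Type) [CommRing R] (x : Fin d → Fin n → R) (w : Word n d) :
    (wordBasis R n d).repr (toTensorSpace R n d (PiTensorProduct.tprod R x)) w =
      ∏ r, x r (w r) := by
  simp [wordBasis]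

theorem permAction_wordBasis (R : Type) [CommRing R] (σ : Equiv.Perm (Fin d)) (w : Word n d) :
    permAction R n d σ (wordBasis R n d w) = wordBasis R n d (w ∘ σ.symm) := by
  simp only [wordBasis_apply, permAction, LinearEquiv.conj_apply, LinearMap.comp_apply,
    LinearEquiv.coe_coe, LinearEquiv.symm_apply_apply]
  rw [PiTensorProduct.reindex_tprod]
  rfl

theorem repr_permAction (R : Type) [CommRing R] (σ : Equiv.Perm (Fin d))
    (t : TensorSpace R n d) (w : Word n d) :
    (wordBasis R n d).repr (permAction R n d σ t) w = (wordBasis R n d).repr t (w ∘ σ) := by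
  have h : (wordBasis R n d).coord w ∘ₗ permAction R n d σ = (wordBasis R n d).coord (w ∘ σ) := by
    refine (wordBasis R n d).ext fun v => ?_
    have hvw : v ∘ σ.symm = w ↔ v = w ∘ σ := by
      constructor
      · rintro rfl; ext r; simp
      · rintro rfl; ext r; simp
    simp [permAction_wordBasis, Finsupp.single_apply, hvw]
  exact LinearMap.congr_fun h t

theorem tensorCast_wordBasis (w : Word n d) :
    tensorCast n d (wordBasis ℤ n d w) = wordBasis ℚ n d w := by
  rw [wordBasis_apply, wordBasis_apply]
  change PiTensorProduct.lift _ (PiTensorProduct.tprod ℤ _) = _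
  rw [PiTensorProduct.lift.tprod]
  change toTensorSpace ℚ n d (PiTensorProduct.tprod ℚ _) = _
  congr 2
  funext r
  ext k
  by_cases h : k = w r
  · subst h; simp [vecCast]
  · simp [vecCast, h]

/-- Additive maps on `V_ℤ^{⊗ d}` are determined by their values on words. -/
theorem addHom_ext_wordBasis {A : Type*} [AddCommGroup A] {φ ψ : TensorSpace ℤ n d →+ A}
    (h : ∀ w, φ (wordBasis ℤ n d w) = ψ (wordBasis ℤ n d w)) : φ = ψ := by
  ext t
  -- The scalar action of the module structure and the `ℤ`-action of the additive group on tensor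
  -- space are propositionally, not definitionally, equal.
  have hz : ∀ (m : Module ℤ (TensorSpace ℤ n d)) (χ : TensorSpace ℤ n d →+ A) (c : ℤ)
      (x : TensorSpace ℤ n d), χ (m.toSMul.smul c x) = c • χ x := by
    intro m χ c x
    rw [← map_zsmul]
    exact congrArg χ (int_smul_eq_zsmul m c x)
  rw [← (wordBasis ℤ n d).sum_repr t, map_sum, map_sum]
  exact Finset.sum_congr rfl fun w _ => (hz _ φ _ _).trans ((hz _ ψ _ _).trans (by rw [h])).symm

theorem repr_tensorCast (t : TensorSpace ℤ n d) (w : Word n d) :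
    (wordBasis ℚ n d).repr (tensorCast n d t) w = ((wordBasis ℤ n d).repr t w : ℚ) := by
  have h : ((wordBasis ℚ n d).coord w).toAddMonoidHom.comp (tensorCast n d).toAddMonoidHom =
      (Int.castAddHom ℚ).comp ((wordBasis ℤ n d).coord w).toAddMonoidHom := by
    refine addHom_ext_wordBasis fun v => ?_
    change (wordBasis ℚ n d).repr (tensorCast n d (wordBasis ℤ n d v)) w =
      (((wordBasis ℤ n d).repr (wordBasis ℤ n d v) w : ℤ) : ℚ)
    by_cases hvw : v = w <;>
      simp [tensorCast_wordBasis, hvw]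
  exact DFunLike.congr_fun h t

/-- A matrix indexed by words represents an element of the Schur algebra if and only if it is
invariant under simultaneous permutation of the places of its two indices. -/
theorem mem_schurAlgebra_iff (R : Type) [CommRing R] (F : Module.End R (TensorSpace R n d)) :
    F ∈ schurAlgebra R n d ↔ ∀ (σ : Equiv.Perm (Fin d)) (i j : Word n d),
      LinearMap.toMatrixAlgEquiv (wordBasis R n d) F (i ∘ σ) (j ∘ σ) =
        LinearMap.toMatrixAlgEquiv (wordBasis R n d) F i j := by
  simp only [schurAlgebra, Subalgebra.mem_centralizer_iff, Set.forall_mem_range,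
    LinearMap.toMatrixAlgEquiv_apply]
  refine forall_congr' fun σ => ⟨fun h i j => ?_, fun h => ?_⟩
  · have := congrArg (fun t => (wordBasis R n d).repr t i)
      (LinearMap.congr_fun h (wordBasis R n d (j ∘ σ)))
    simp only [Module.End.mul_apply, repr_permAction, permAction_wordBasis] at this
    rw [this]
    congr 4
    ext r; simp
  · refine (wordBasis R n d).ext fun j => (wordBasis R n d).ext_elem fun i => ?_
    simp only [Module.End.mul_apply, repr_permAction, permAction_wordBasis]
    rw [← h i (j ∘ σ.symm)]
    congr 4
    ext r; simp

/-- The matrix of an element of `S(n,d)` with respect to the basis of words. -/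
def toWordMatrix (n d : ℕ) : schurAlgebra ℚ n d →ₐ[ℚ] Matrix (Word n d) (Word n d) ℚ :=
  (LinearMap.toMatrixAlgEquiv (wordBasis ℚ n d)).toAlgHom.comp (schurAlgebra ℚ n d).val

theorem toWordMatrix_apply (F : schurAlgebra ℚ n d) (i j : Word n d) :
    toWordMatrix n d F i j = (wordBasis ℚ n d).repr (F.1 (wordBasis ℚ n d j)) i := by
  simp [toWordMatrix, LinearMap.toMatrixAlgEquiv_apply]

theorem toWordMatrix_injective : Function.Injective (toWordMatrix n d) := by
  intro F G h
  exact Subtype.ext ((LinearMap.toMatrixAlgEquiv (wordBasis ℚ n d)).injective h)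

theorem toWordMatrix_comp_perm (F : schurAlgebra ℚ n d) (σ : Equiv.Perm (Fin d))
    (i j : Word n d) :
    toWordMatrix n d F (i ∘ σ) (j ∘ σ) = toWordMatrix n d F i j :=
  (mem_schurAlgebra_iff ℚ F.1).1 F.2 σ i j

/-- The integral Schur algebra consists of the elements whose matrices are integral. -/
theorem mem_integralSchur_iff (F : schurAlgebra ℚ n d) :
    F ∈ integralSchur n d ↔ ∀ i j, ∃ z : ℤ, toWordMatrix n d F i j = z := by
  constructor
  · rintro ⟨g, -, hg⟩ i j
    refine ⟨(wordBasis ℤ n d).repr (g (wordBasis ℤ n d j)) i, ?_⟩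
    rw [toWordMatrix_apply, ← tensorCast_wordBasis, hg, repr_tensorCast]
  · intro h
    choose A hA using h
    refine ⟨(LinearMap.toMatrixAlgEquiv (wordBasis ℤ n d)).symm (Matrix.of A), ?_, ?_⟩
    · rw [mem_schurAlgebra_iff]
      intro σ i j
      have := toWordMatrix_comp_perm F σ i j
      simp only [hA] at this
      simpa using this
    · intro t
      let g := (LinearMap.toMatrixAlgEquiv (wordBasis ℤ n d)).symm (Matrix.of A)
      have h : F.1.toAddMonoidHom.comp (tensorCast n d).toAddMonoidHom =
          (tensorCast n d).toAddMonoidHom.comp g.toAddMonoidHom := by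
        refine addHom_ext_wordBasis fun j => (wordBasis ℚ n d).ext_elem fun i => ?_
        change (wordBasis ℚ n d).repr (F.1 (tensorCast n d (wordBasis ℤ n d j))) i =
          (wordBasis ℚ n d).repr (tensorCast n d (g (wordBasis ℤ n d j))) i
        rw [tensorCast_wordBasis, repr_tensorCast, ← toWordMatrix_apply, hA,
          ← LinearMap.toMatrixAlgEquiv_apply]
        simp [g]
      exact DFunLike.congr_fun h t

/-! ### Matrices of divided powers and of the weight idempotents -/

theorem toWordMatrix_unitAction (a b : Fin n) (i j : Word n d) :
    toWordMatrix n d (unitAction n d a b) i j =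
      ∑ r, if i r = a ∧ Function.update i r b = j then (1 : ℚ) else 0 := by
  rw [toWordMatrix_apply, wordBasis_apply]
  simp only [unitAction, derivAction, LinearEquiv.conj_apply, LinearMap.comp_apply,
    LinearEquiv.coe_coe, LinearEquiv.symm_apply_apply, LinearMap.sum_apply, map_sum,
    PiTensorProduct.map_tprod, Finsupp.finsetSum_apply, wordBasis_repr_tprod]
  refine Finset.sum_congr rfl fun r _ => ?_
  have key : ∀ s, (Function.update (fun _ : Fin d =>
        (LinearMap.id : (Fin n → ℚ) →ₗ[ℚ] (Fin n → ℚ))) r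
        (Matrix.toLin' (Matrix.single a b 1)) s) (Pi.single (j s) 1) (i s) =
      if (s = r → i r = a) ∧ Function.update i r b s = j s then 1 else 0 := by
    intro s
    by_cases hs : s = r
    · subst hs
      by_cases h1 : i s = a <;> by_cases h2 : b = j s <;>
        simp [h1, h2, eq_comm (a := a)]
    · simp [hs, Pi.single_apply]
  rw [Finset.prod_congr rfl fun s _ => key s, Fintype.prod_ite_zero]
  simp only [Finset.prod_const_one]
  refine if_congr ⟨fun h => ⟨(h r).1 rfl, funext fun s => (h s).2⟩, fun h s => ⟨fun _ => h.1, ?_⟩⟩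
    rfl rfl
  rw [h.2]

/-- The matrix of the divided power `E_{ab}^{(m)}` for `a ≠ b`: the entry at `(i, j)` is `1` if `i`
arises from `j` by changing exactly `m` letters `b` to `a`, and is `0` otherwise. -/
def moveMatrix (n d : ℕ) (a b : Fin n) (m : ℕ) : Matrix (Word n d) (Word n d) ℚ :=
  Matrix.of fun i j =>
    if (∀ r, i r = j r ∨ (i r = a ∧ j r = b)) ∧ hammingDist i j = m then 1 else 0

theorem moveMatrix_apply (a b : Fin n) (m : ℕ) (i j : Word n d) :
    moveMatrix n d a b m i j =
      if (∀ r, i r = j r ∨ (i r = a ∧ j r = b)) ∧ hammingDist i j = m then 1 else 0 := rfl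

theorem moveMatrix_zero (a b : Fin n) : moveMatrix n d a b 0 = 1 := by
  ext i j
  rw [moveMatrix_apply, Matrix.one_apply]
  refine if_congr ?_ rfl rfl
  rw [hammingDist_eq_zero]
  exact ⟨fun h => h.2, fun h => ⟨fun r => Or.inl (by rw [h]), h⟩⟩

/-- The recursion `E_{ab} E_{ab}^{(m)} = (m+1) E_{ab}^{(m+1)}`, obtained by counting the places at
which the last change of a letter can take place. -/
theorem unitAction_mul_moveMatrix {a b : Fin n} (hab : a ≠ b) (m : ℕ) :
    toWordMatrix n d (unitAction n d a b) * moveMatrix n d a b m =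
      (m + 1 : ℚ) • moveMatrix n d a b (m + 1) := by
  ext i j
  have h1 : (toWordMatrix n d (unitAction n d a b) * moveMatrix n d a b m) i j =
      ∑ r, if i r = a then moveMatrix n d a b m (Function.update i r b) j else 0 := by
    simp only [Matrix.mul_apply, toWordMatrix_unitAction, Finset.sum_mul, ite_mul, one_mul,
      zero_mul, ite_and]
    rw [Finset.sum_comm]
    refine Finset.sum_congr rfl fun r _ => ?_
    split_ifs <;> simp
  have hterm : ∀ r, (if i r = a then moveMatrix n d a b m (Function.update i r b) j else 0) =
      if i r ≠ j r then moveMatrix n d a b (m + 1) i j else 0 := by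
    intro r
    have hham : i r ≠ j r → j r = b →
        hammingDist i j = hammingDist (Function.update i r b) j + 1 := by
      intro hne hb
      have : ({s | i s ≠ j s} : Finset (Fin d)) =
          insert r ({s | Function.update i r b s ≠ j s} : Finset (Fin d)) := by
        ext s
        by_cases hs : s = r
        · subst hs; simpa using hne
        · simp [hs]
      unfold hammingDist
      rw [this, Finset.card_insert_of_notMem (by simp [hb])]
    by_cases hia : i r = a
    · by_cases hjb : j r = b
      · have hne : i r ≠ j r := by rw [hia, hjb]; exact hab
        rw [if_pos hia, if_pos hne, moveMatrix_apply, moveMatrix_apply]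
        refine if_congr ?_ rfl rfl
        rw [hham hne hjb, Nat.add_right_cancel_iff]
        refine and_congr_left fun _ => forall_congr' fun s => ?_
        by_cases hs : s = r
        · subst hs; simp [hia, hjb]
        · simp [hs]
      · rw [if_pos hia, moveMatrix_apply, moveMatrix_apply, if_neg]
        · split_ifs with h2 h3
          · rcases h3.1 r with h | h
            · exact absurd h h2
            · exact absurd h.2 hjb
          · rfl
          · rfl
        · intro h
          rcases h.1 r with h | h
          · exact hjb (by simpa using h.symm)
          · exact hjb h.2
    · rw [if_neg hia, moveMatrix_apply]
      split_ifs with h2 h3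
      · rcases h3.1 r with h | h
        · exact absurd h h2
        · exact absurd h.1 hia
      · rfl
      · rfl
  rw [h1, Finset.sum_congr rfl fun r _ => hterm r, ← Finset.sum_filter, Finset.sum_const,
    Matrix.smul_apply, smul_eq_mul, nsmul_eq_mul, moveMatrix_apply]
  split_ifs with h
  · have := h.2
    unfold hammingDist at this
    rw [this]
    push_cast
    rfl
  · simp

theorem dividedPower_zero (x : schurAlgebra ℚ n d) : dividedPower x 0 = 1 := by
  simp [dividedPower]

theorem dividedPower_succ (x : schurAlgebra ℚ n d) (m : ℕ) :
    dividedPower x (m + 1) = ((m + 1 : ℚ)⁻¹) • (x * dividedPower x m) := by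
  simp only [dividedPower, mul_smul_comm, smul_smul, pow_succ', Nat.factorial_succ]
  push_cast
  rw [mul_inv]

theorem toWordMatrix_dividedPower {a b : Fin n} (hab : a ≠ b) (m : ℕ) :
    toWordMatrix n d (dividedPower (unitAction n d a b) m) = moveMatrix n d a b m := by
  induction m with
  | zero => rw [dividedPower_zero, map_one, moveMatrix_zero]
  | succ m ih =>
    have : (m + 1 : ℚ) ≠ 0 := by positivity
    rw [dividedPower_succ, map_smul, map_mul, ih, unitAction_mul_moveMatrix hab, smul_smul,
      inv_mul_cancel₀ this, one_smul]

/-- The weight of a word: the number of occurrences of each letter. -/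
def weight (w : Word n d) (a : Fin n) : ℕ := Finset.card {r | w r = a}

theorem sum_weight (w : Word n d) : ∑ a, weight w a = d := by
  have := Finset.card_eq_sum_card_fiberwise (f := w) (s := Finset.univ) (t := Finset.univ)
    (fun _ _ => Finset.mem_coe.2 (Finset.mem_univ _))
  simpa [weight] using this.symm

theorem toWordMatrix_H (a : Fin n) :
    toWordMatrix n d (H n d a) = Matrix.diagonal fun w => (weight w a : ℚ) := by
  ext i j
  rw [H, toWordMatrix_unitAction, Matrix.diagonal_apply, weight, Finset.card_filter]
  have : ∀ r, (i r = a ∧ Function.update i r a = j) ↔ (i r = a ∧ i = j) := fun r =>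
    and_congr_right fun h => by rw [← h, Function.update_eq_self]
  simp only [this]
  split_ifs with h
  · simp [h]
  · simp [h]

theorem binom_eq (x : schurAlgebra ℚ n d) (m : ℕ) :
    binom x m = ((m.factorial : ℚ)⁻¹) •
      ((List.range m).map fun k : ℕ => x - (k : schurAlgebra ℚ n d)).prod := by
  -- In `binom` the range is cast to the algebra through the monad structure of lists.
  simp only [binom, List.bind_eq_flatMap, List.pure_def, List.map_flatMap, List.map_cons,
    List.map_nil]
  rw [List.map_eq_flatMap]

theorem toWordMatrix_binom_H (a : Fin n) (m : ℕ) :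
    toWordMatrix n d (binom (H n d a) m) =
      Matrix.diagonal fun w => ((weight w a).choose m : ℚ) := by
  have hprod : ∀ l : ℕ, toWordMatrix n d
      ((List.range l).map fun k : ℕ => H n d a - (k : schurAlgebra ℚ n d)).prod =
        Matrix.diagonal fun w => ((weight w a).descFactorial l : ℚ) := by
    intro l
    induction l with
    | zero => simp
    | succ l ih =>
      rw [List.range_succ, List.map_append, List.prod_append, map_mul, ih]
      simp only [List.map_cons, List.map_nil, List.prod_cons, List.prod_nil, mul_one, map_sub,
        toWordMatrix_H, map_natCast]
      rw [← Matrix.diagonal_natCast, Matrix.diagonal_sub, Matrix.diagonal_mul_diagonal]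
      congr 1
      funext w
      rw [Nat.descFactorial_succ]
      rcases le_or_gt l (weight w a) with h | h
      · push_cast [Nat.cast_sub h]; ring
      · simp [Nat.descFactorial_eq_zero_iff_lt.2 h]
  rw [binom_eq, map_smul, hprod, ← Matrix.diagonal_smul]
  congr 1
  funext w
  rw [Pi.smul_apply, smul_eq_mul, Nat.choose_eq_descFactorial_div_factorial,
    Nat.cast_div (Nat.factorial_dvd_descFactorial _ _) (by positivity)]
  field_simp

/-- The projection onto the span of the words of weight `λ`. -/
def weightMatrix (n d : ℕ) (l : Fin n → ℕ) : Matrix (Word n d) (Word n d) ℚ :=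
  Matrix.diagonal fun w => if weight w = l then 1 else 0

theorem eq_of_le_of_sum_eq {l l' : Fin n → ℕ} (h : l ≤ l') (hs : ∑ i, l i = ∑ i, l' i) :
    l = l' :=
  funext fun i => (Finset.sum_eq_sum_iff_of_le fun i _ => h i).1 hs i (Finset.mem_univ i)

theorem toWordMatrix_idemMonomial (l : Comp n d) :
    toWordMatrix n d (KostantMonomial.eval d (idemMonomial l.1)) = weightMatrix n d l.1 := by
  have : toWordMatrix n d (KostantMonomial.eval d (idemMonomial l.1)) =
      Matrix.diagonal fun w => ∏ a, ((weight w a).choose (l.1 a) : ℚ) := by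
    rw [KostantMonomial.eval, idemMonomial, map_list_prod, List.map_map, List.map_ofFn]
    have h : ∀ (k : ℕ) (g : Fin k → Word n d → ℚ),
        (List.ofFn fun a => Matrix.diagonal (g a)).prod =
          Matrix.diagonal fun w => ∏ a, g a w := by
      intro k
      induction k with
      | zero => intro g; simp
      | succ k ih =>
        intro g
        rw [List.ofFn_succ, List.prod_cons, ih, Matrix.diagonal_mul_diagonal]
        simp [Fin.prod_univ_succ]
    rw [← h]
    congr 2
    funext a
    simp [KostantFactor.eval, toWordMatrix_binom_H]
  rw [this, weightMatrix]
  congr 1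
  funext w
  split_ifs with hw
  · rw [hw]; simp
  · by_contra hne
    rw [← ne_eq, Finset.prod_ne_zero_iff] at hne
    refine hw (eq_of_le_of_sum_eq (fun a => ?_) ?_).symm
    · by_contra hlt
      exact hne a (Finset.mem_univ a) (by rw [Nat.choose_eq_zero_of_lt (not_le.1 hlt)]; simp)
    · rw [l.2, sum_weight]

/-! ### Root vectors -/

theorem toWordMatrix_unitAction_mul (a b a' b' : Fin n) (i j : Word n d) :
    toWordMatrix n d (unitAction n d a b * unitAction n d a' b') i j =
      ∑ r, ∑ s, if i r = a ∧ Function.update i r b s = a' ∧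
        Function.update (Function.update i r b) s b' = j then (1 : ℚ) else 0 := by
  simp only [map_mul, Matrix.mul_apply, toWordMatrix_unitAction, Finset.sum_mul, ite_mul, one_mul,
    zero_mul, ite_and]
  rw [Finset.sum_comm]
  refine Finset.sum_congr rfl fun r _ => ?_
  split_ifs <;> simp

theorem unitAction_commutator (a b c : Fin n) (hac : a ≠ c) :
    unitAction n d a b * unitAction n d b c - unitAction n d b c * unitAction n d a b =
      unitAction n d a c := by
  apply toWordMatrix_injective
  ext i j
  rw [map_sub, Matrix.sub_apply, toWordMatrix_unitAction_mul, toWordMatrix_unitAction_mul,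
    Finset.sum_comm (f := fun r s => if i r = b ∧ _ then (1 : ℚ) else 0),
    toWordMatrix_unitAction, ← Finset.sum_sub_distrib]
  refine Finset.sum_congr rfl fun r _ => ?_
  rw [← Finset.sum_sub_distrib, Finset.sum_eq_single r]
  · simp [hac.symm]
  · intro s _ hs
    rw [Function.update_of_ne hs, Function.update_of_ne hs.symm, Function.update_comm hs,
      sub_eq_zero]
    exact if_congr (by tauto) rfl rfl
  · simp

theorem rootVector_eq (i j : Fin n) (hij : i ≠ j) :
    rootVector n d i j hij = unitAction n d i j := by
  have hpos : ∀ (k i : ℕ) (h : i + k + 1 < n),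
      posRootVector n d k i h = unitAction n d ⟨i, by omega⟩ ⟨i + k + 1, h⟩ := by
    intro k
    induction k with
    | zero => intro i h; rfl
    | succ k ih =>
      intro i h
      rw [posRootVector, ih (i + 1) (by omega), e, unitAction_commutator]
      · congr 2; omega
      · simp only [ne_eq, Fin.mk.injEq]; omega
  have hneg : ∀ (k i : ℕ) (h : i + k + 1 < n),
      negRootVector n d k i h = unitAction n d ⟨i + k + 1, h⟩ ⟨i, by omega⟩ := by
    intro k
    induction k with
    | zero => intro i h; rfl
    | succ k ih =>
      intro i h
      rw [negRootVector, ih (i + 1) (by omega), f, unitAction_commutator]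
      · congr 2; omega
      · simp only [ne_eq, Fin.mk.injEq]; omega
  rw [rootVector]
  split_ifs with h
  · rw [hpos]
    congr 1
    ext; simp only; have := Fin.lt_def.1 h; omega
  · rw [hneg]
    congr 1
    ext; simp only; have := Fin.val_ne_of_ne hij; have : ¬ i.val < j.val := h; omega

/-! ### Leading terms with respect to the Hamming distance -/

/-- The number of places at which the pair of words `(i, j)` has the pair of letters `p`. -/
def pairCount (i j : Word n d) (p : Fin n × Fin n) : ℕ := Finset.card {r | (i r, j r) = p}

/-- The words `i` and `j` differ only by pairs of letters from `s`, and each `p ∈ s` occurs exactly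
`m p` times. -/
def Matches (s : Finset (Fin n × Fin n)) (m : Fin n × Fin n → ℕ) (i j : Word n d) : Prop :=
  (∀ p ∈ s, pairCount i j p = m p) ∧ ∀ r, i r ≠ j r → (i r, j r) ∈ s

instance (s : Finset (Fin n × Fin n)) (m : Fin n × Fin n → ℕ) (i j : Word n d) :
    Decidable (Matches s m i j) :=
  inferInstanceAs (Decidable ((∀ p ∈ s, pairCount i j p = m p) ∧ ∀ r, i r ≠ j r → (i r, j r) ∈ s))

theorem sum_pairCount (s : Finset (Fin n × Fin n)) (i j : Word n d) :
    ∑ p ∈ s, pairCount i j p = Finset.card {r | (i r, j r) ∈ s} := by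
  rw [Finset.card_eq_sum_card_fiberwise (f := fun r => (i r, j r)) (t := s)
    (fun r hr => by simpa using hr)]
  refine Finset.sum_congr rfl fun p hp => ?_
  rw [pairCount, Finset.filter_filter]
  congr 1
  ext r
  simp only [Finset.mem_filter, Finset.mem_univ, true_and]
  exact ⟨fun h => ⟨h ▸ hp, h⟩, fun h => h.2⟩

theorem Matches.hammingDist_eq {s : Finset (Fin n × Fin n)} (hs : ∀ p ∈ s, p.1 ≠ p.2)
    {m : Fin n × Fin n → ℕ} {i j : Word n d} (h : Matches s m i j) :
    hammingDist i j = ∑ p ∈ s, m p := by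
  rw [← Finset.sum_congr rfl h.1, sum_pairCount, hammingDist]
  congr 1
  ext r
  simp only [Finset.mem_filter, Finset.mem_univ, true_and]
  exact ⟨h.2 r, fun hr => hs _ hr⟩

/-- If the Hamming triangle inequality for `i, w, j` is an equality, then no place changes twice. -/
theorem eq_or_eq_of_hammingDist_add_le {i w j : Word n d}
    (h : hammingDist i w + hammingDist w j ≤ hammingDist i j) (r : Fin d) :
    i r = w r ∨ w r = j r := by
  by_contra! hr
  have hsub : ({r | i r ≠ j r} : Finset (Fin d)) ⊆
      ({r | i r ≠ w r} : Finset (Fin d)) ∪ ({r | w r ≠ j r} : Finset (Fin d)) := by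
    intro s
    simp only [Finset.mem_filter, Finset.mem_univ, true_and, Finset.mem_union]
    intro hs
    by_contra! hs'
    exact hs (hs'.1.trans hs'.2)
  have h1 := Finset.card_le_card hsub
  have h2 := Finset.card_union_add_card_inter ({r | i r ≠ w r} : Finset (Fin d))
    ({r | w r ≠ j r} : Finset (Fin d))
  have h3 : 0 < Finset.card (({r | i r ≠ w r} : Finset (Fin d)) ∩
      ({r | w r ≠ j r} : Finset (Fin d))) :=
    Finset.card_pos.2 ⟨r, by simp [hr.1, hr.2]⟩
  unfold hammingDist at h
  omega

/-- The matrix `X` vanishes at pairs of words of Hamming distance larger than `∑ p ∈ s, m p`, and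
at pairs of this distance it is the characteristic function of `Matches s m`. -/
def Leading (X : Matrix (Word n d) (Word n d) ℚ) (s : Finset (Fin n × Fin n))
    (m : Fin n × Fin n → ℕ) : Prop :=
  ∀ i j, (X i j ≠ 0 → hammingDist i j ≤ ∑ p ∈ s, m p) ∧
    (∑ p ∈ s, m p ≤ hammingDist i j → X i j = if Matches s m i j then 1 else 0)

theorem Leading.one (m : Fin n × Fin n → ℕ) :
    Leading (1 : Matrix (Word n d) (Word n d) ℚ) ∅ m := by
  intro i j
  rw [Matrix.one_apply]
  constructor
  · intro h
    have : i = j := by by_contra hne; simp [hne] at h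
    simp [this]
  · intro _
    refine if_congr ?_ rfl rfl
    simp [Matches, funext_iff]

theorem Leading.moveMatrix (p : Fin n × Fin n) (hp : p.1 ≠ p.2) (m : Fin n × Fin n → ℕ) :
    Leading (moveMatrix n d p.1 p.2 (m p)) {p} m := by
  intro i j
  rw [moveMatrix_apply, Finset.sum_singleton]
  constructor
  · intro h
    by_contra hlt
    exact h (if_neg fun h' => hlt h'.2.le)
  · intro _
    refine if_congr ⟨fun h => ⟨?_, ?_⟩, fun h => ⟨fun r => ?_, ?_⟩⟩ rfl rfl
    · intro q hq
      rw [Finset.mem_singleton] at hq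
      subst hq
      rw [← h.2, pairCount, hammingDist]
      congr 1
      ext r
      simp only [Finset.mem_filter, Finset.mem_univ, true_and, Prod.ext_iff]
      refine ⟨fun hr => ?_, fun hr => (h.1 r).resolve_left hr⟩
      rw [hr.1, hr.2]; exact hp
    · intro r hr
      simpa [Prod.ext_iff] using (h.1 r).resolve_left hr
    · by_cases hr : i r = j r
      · exact Or.inl hr
      · have := h.2 r hr
        rw [Finset.mem_singleton] at this
        exact Or.inr ⟨congrArg Prod.fst this, congrArg Prod.snd this⟩
    · simpa using h.hammingDist_eq (by simpa using hp)

/-- The word through which a pair of words `(i, j)` has to pass if the pairs of letters in `s` are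
to be changed last: the letter is that of `j` at the places where `(i, j)` lies in `s`, and that
of `i` at the other places. -/
def midWord (s : Finset (Fin n × Fin n)) (i j : Word n d) : Word n d :=
  fun r => if (i r, j r) ∈ s then j r else i r

section Product

variable {s₁ s₂ : Finset (Fin n × Fin n)} {m : Fin n × Fin n → ℕ}

theorem matches_midWord_iff (h₁ : ∀ p ∈ s₁, p.1 ≠ p.2) (h₂ : ∀ p ∈ s₂, p.1 ≠ p.2)
    (hd : Disjoint s₁ s₂) (i j : Word n d) :
    Matches s₁ m i (midWord s₁ i j) ∧ Matches s₂ m (midWord s₁ i j) j ↔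
      Matches (s₁ ∪ s₂) m i j := by
  have c₁ : ∀ p ∈ s₁, pairCount i (midWord s₁ i j) p = pairCount i j p := by
    intro p hp
    unfold pairCount midWord
    congr 1
    ext r
    simp only [Finset.mem_filter, Finset.mem_univ, true_and]
    split_ifs with h
    · rfl
    · refine ⟨fun hr => absurd ?_ (h₁ p hp), fun hr => absurd (hr ▸ hp) h⟩
      rw [← hr]
  have c₂ : ∀ p ∈ s₂, pairCount (midWord s₁ i j) j p = pairCount i j p := by
    intro p hp
    unfold pairCount midWord
    congr 1
    ext r
    simp only [Finset.mem_filter, Finset.mem_univ, true_and]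
    split_ifs with h
    · refine ⟨fun hr => absurd ?_ (h₂ p hp), fun hr => ?_⟩
      · rw [← hr]
      · exact absurd (hr ▸ hp) (Finset.disjoint_left.1 hd h)
    · rfl
  have d₁ : (∀ r, i r ≠ midWord s₁ i j r → (i r, midWord s₁ i j r) ∈ s₁) := by
    intro r hr
    unfold midWord at hr ⊢
    split_ifs at hr ⊢ with h
    · exact h
    · exact absurd rfl hr
  have d₂ : (∀ r, midWord s₁ i j r ≠ j r → (midWord s₁ i j r, j r) ∈ s₂) ↔
      ∀ r, i r ≠ j r → (i r, j r) ∈ s₁ ∪ s₂ := by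
    refine forall_congr' fun r => ?_
    unfold midWord
    split_ifs with h
    · simp [h]
    · simp [h]
  simp only [Matches, Finset.forall_mem_union]
  rw [← d₂]
  constructor
  · rintro ⟨⟨a, -⟩, b, c⟩
    exact ⟨⟨fun p hp => (c₁ p hp).symm.trans (a p hp), fun p hp => (c₂ p hp).symm.trans (b p hp)⟩,
      c⟩
  · rintro ⟨⟨a, b⟩, c⟩
    exact ⟨⟨fun p hp => (c₁ p hp).trans (a p hp), d₁⟩, fun p hp => (c₂ p hp).trans (b p hp), c⟩

theorem Leading.midWord_unique {X₁ X₂ : Matrix (Word n d) (Word n d) ℚ}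
    (hX₁ : Leading X₁ s₁ m) (hX₂ : Leading X₂ s₂ m) (hd : Disjoint s₁ s₂) {i w j : Word n d}
    (h : ∑ p ∈ s₁, m p + ∑ p ∈ s₂, m p ≤ hammingDist i j) (e₁ : X₁ i w ≠ 0) (e₂ : X₂ w j ≠ 0) :
    w = midWord s₁ i j ∧ Matches s₁ m i w ∧ Matches s₂ m w j := by
  have l₁ := (hX₁ i w).1 e₁
  have l₂ := (hX₂ w j).1 e₂
  have tri := hammingDist_triangle i w j
  have q₁ : Matches s₁ m i w := by
    by_contra hne
    exact e₁ (by rw [(hX₁ i w).2 (by omega), if_neg hne])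
  have q₂ : Matches s₂ m w j := by
    by_contra hne
    exact e₂ (by rw [(hX₂ w j).2 (by omega), if_neg hne])
  refine ⟨funext fun r => ?_, q₁, q₂⟩
  unfold midWord
  by_cases hr : i r = w r
  · by_cases hr' : w r = j r
    · simp [hr, hr']
    · rw [if_neg, hr]
      exact fun hmem => Finset.disjoint_left.1 hd hmem (hr ▸ q₂.2 r hr')
  · have hr' : w r = j r :=
      (eq_or_eq_of_hammingDist_add_le (le_trans (add_le_add l₁ l₂) h) r).resolve_left hr
    rw [if_pos, hr']
    exact hr' ▸ q₁.2 r hr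

/-- At the maximal Hamming distance only one word contributes to an entry of a product: each
place changes at most once, hence the order of the changes determines the intermediate word. -/
theorem Leading.mul_diagonal_mul {X₁ X₂ : Matrix (Word n d) (Word n d) ℚ}
    (hX₁ : Leading X₁ s₁ m) (hX₂ : Leading X₂ s₂ m) (h₁ : ∀ p ∈ s₁, p.1 ≠ p.2)
    (h₂ : ∀ p ∈ s₂, p.1 ≠ p.2) (hd : Disjoint s₁ s₂) (g : Word n d → ℚ) {i j : Word n d}
    (h : ∑ p ∈ s₁, m p + ∑ p ∈ s₂, m p ≤ hammingDist i j) :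
    (X₁ * Matrix.diagonal g * X₂) i j =
      if Matches (s₁ ∪ s₂) m i j then g (midWord s₁ i j) else 0 := by
  rw [Matrix.mul_apply]
  simp only [Matrix.mul_diagonal]
  have hne : ∀ w, X₁ i w * g w * X₂ w j ≠ 0 →
      w = midWord s₁ i j ∧ Matches s₁ m i w ∧ Matches s₂ m w j := fun w hw =>
    hX₁.midWord_unique hX₂ hd h (left_ne_zero_of_mul (left_ne_zero_of_mul hw))
      (right_ne_zero_of_mul hw)
  rw [Finset.sum_eq_single (midWord s₁ i j)
    (fun w _ hw => by_contra fun hw' => hw (hne w hw').1) (by simp)]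
  split_ifs with hM
  · obtain ⟨q₁, q₂⟩ := (matches_midWord_iff h₁ h₂ hd i j).2 hM
    rw [(hX₁ _ _).2 (q₁.hammingDist_eq h₁).ge, (hX₂ _ _).2 (q₂.hammingDist_eq h₂).ge, if_pos q₁,
      if_pos q₂, one_mul, mul_one]
  · by_contra hw
    exact hM ((matches_midWord_iff h₁ h₂ hd i j).1 (hne _ hw).2)

theorem Leading.mul {X₁ X₂ : Matrix (Word n d) (Word n d) ℚ}
    (hX₁ : Leading X₁ s₁ m) (hX₂ : Leading X₂ s₂ m) (h₁ : ∀ p ∈ s₁, p.1 ≠ p.2)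
    (h₂ : ∀ p ∈ s₂, p.1 ≠ p.2) (hd : Disjoint s₁ s₂) : Leading (X₁ * X₂) (s₁ ∪ s₂) m := by
  intro i j
  rw [Finset.sum_union hd]
  constructor
  · intro hne
    rw [Matrix.mul_apply] at hne
    obtain ⟨w, -, hw⟩ := Finset.exists_ne_zero_of_sum_ne_zero hne
    exact (hammingDist_triangle i w j).trans (add_le_add ((hX₁ i w).1 (left_ne_zero_of_mul hw))
      ((hX₂ w j).1 (right_ne_zero_of_mul hw)))
  · intro h
    have := hX₁.mul_diagonal_mul hX₂ h₁ h₂ hd (fun _ => 1) h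
    rwa [Matrix.diagonal_one, mul_one] at this

end Product

theorem Leading.list_prod (m : Fin n × Fin n → ℕ) (L : List (Fin n × Fin n)) (hL : L.Nodup)
    (hne : ∀ p ∈ L, p.1 ≠ p.2) :
    Leading (L.map fun p => SchurAlg.moveMatrix n d p.1 p.2 (m p)).prod L.toFinset m := by
  induction L with
  | nil => simpa using Leading.one m
  | cons p L ih =>
    rw [List.nodup_cons] at hL
    rw [List.map_cons, List.prod_cons, List.toFinset_cons, Finset.insert_eq]
    refine (Leading.moveMatrix p (hne p (by simp)) m).mul
      (ih hL.2 fun q hq => hne q (by simp [hq])) ?_ ?_ ?_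
    · simpa using hne p (by simp)
    · intro q hq
      exact hne q (by simp [List.mem_toFinset.1 hq])
    · simpa using hL.1

/-! ### Bases from unitriangular families -/

open Classical in
/-- A family of integral elements `y p` that is unitriangular with respect to the Hamming distance
is a `ℤ`-basis of the integral Schur algebra. Here `τ` assigns to each pair of words the index of
its orbit under simultaneous permutations of the places. -/
theorem exists_basis_of_unitriangular {ι : Type*} (y : ι → schurAlgebra ℚ n d) (deg : ι → ℕ)
    (τ : Word n d → Word n d → ι) (hint : ∀ p, y p ∈ integralSchur n d)
    (hdeg : ∀ i j, deg (τ i j) = hammingDist i j)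
    (hval : ∀ p i j, deg p ≤ hammingDist i j →
      toWordMatrix n d (y p) i j = if τ i j = p then 1 else 0)
    (hsurj : ∀ p, ∃ i j, τ i j = p)
    (hconj : ∀ i j i' j', τ i j = τ i' j' →
      ∃ σ : Equiv.Perm (Fin d), i' = i ∘ σ ∧ j' = j ∘ σ) :
    ∃ b : Module.Basis ι ℤ (integralSchur n d), ∀ p, (b p : schurAlgebra ℚ n d) = y p := by
  let Y : ι → integralSchur n d := fun p => ⟨y p, hint p⟩
  let ent : Word n d → Word n d → integralSchur n d →+ ℚ := fun i j =>
    { toFun := fun F => toWordMatrix n d F.1 i j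
      map_zero' := by simp
      map_add' := fun F G => by simp }
  have entY : ∀ p i j, deg p ≤ hammingDist i j → ent i j (Y p) = if τ i j = p then 1 else 0 :=
    hval
  choose ri rj hr using hsurj
  have : Finite ι := Finite.of_injective (fun p => (ri p, rj p)) fun p q h => by
    obtain ⟨h1, h2⟩ := Prod.ext_iff.1 h
    simp only at h1 h2
    rw [← hr p, ← hr q, h1, h2]
  have := Fintype.ofFinite ι
  have hli : LinearIndependent ℤ Y := by
    rw [linearIndependent_iff']
    intro s g hg p hp
    by_contra hgp
    -- At the orbit of a member of maximal degree all other members of the relation vanish.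
    obtain ⟨q, hq, hmax⟩ := Finset.exists_max_image (s.filter fun q => g q ≠ 0) deg
      ⟨p, Finset.mem_filter.2 ⟨hp, hgp⟩⟩
    rw [Finset.mem_filter] at hq
    refine hq.2 ?_
    have h0 := congrArg (ent (ri q) (rj q)) hg
    rw [map_sum, map_zero, Finset.sum_eq_single q] at h0
    · rw [map_zsmul, entY q _ _ (by rw [← hdeg, hr]), if_pos (hr q)] at h0
      simpa using h0
    · intro p' hp' hne
      rw [map_zsmul]
      by_cases hg' : g p' = 0
      · rw [hg', zero_smul]
      · rw [entY p' _ _ (by rw [← hdeg, hr]; exact hmax p' (Finset.mem_filter.2 ⟨hp', hg'⟩)),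
          if_neg (by rw [hr]; exact hne.symm), smul_zero]
    · exact fun h => absurd hq.1 h
  have hspan : ∀ (k : ℕ) (F : integralSchur n d),
      (∀ i j, k ≤ hammingDist i j → ent i j F = 0) → F ∈ Submodule.span ℤ (Set.range Y) := by
    intro k
    induction k with
    | zero =>
      intro F hF
      have : F = 0 := Subtype.ext (toWordMatrix_injective (by
        ext i j
        exact (hF i j (Nat.zero_le _)).trans (by simp)))
      rw [this]
      exact zero_mem _
    | succ k ih =>
      intro F hF
      have hc := (mem_integralSchur_iff F.1).1 F.2
      choose c hc using hc
      -- Subtracting `G` removes the entries of `F` at Hamming distance `k`.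
      let G : integralSchur n d := ∑ p with deg p = k, c (ri p) (rj p) • Y p
      have hG : G ∈ Submodule.span ℤ (Set.range Y) :=
        Submodule.sum_mem _ fun p _ => Submodule.smul_mem _ _ (Submodule.subset_span ⟨p, rfl⟩)
      have hFG : F - G ∈ Submodule.span ℤ (Set.range Y) := by
        refine ih _ fun i j hij => ?_
        have h1 : ent i j G = ∑ p with deg p = k,
            if τ i j = p then (c (ri p) (rj p) : ℚ) else 0 := by
          rw [map_sum]
          refine Finset.sum_congr rfl fun p hp => ?_
          rw [map_zsmul, entY p i j ((Finset.mem_filter.1 hp).2.trans_le hij)]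
          split_ifs <;> simp
        rw [map_sub, h1, Finset.sum_ite_eq]
        simp only [Finset.mem_filter, Finset.mem_univ, true_and, hdeg]
        split_ifs with hk
        · obtain ⟨σ, h2, h3⟩ := hconj _ _ _ _ (hr (τ i j))
          rw [← hc, sub_eq_zero, ← toWordMatrix_comp_perm F.1 σ, ← h2, ← h3]
          rfl
        · rw [sub_zero]
          exact hF i j (by omega)
      simpa using add_mem hFG hG
  refine ⟨Module.Basis.mk hli fun F _ => hspan (d + 1) F fun i j hij => ?_, fun p => by
    rw [Module.Basis.mk_apply]⟩
  have := hammingDist_le_card_fintype (x := i) (y := j)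
  rw [Fintype.card_fin] at this
  omega

/-! ### Orbits of pairs of words -/

theorem exists_perm_of_card_fiber_eq {X : Type*} [DecidableEq X] {u v : Fin d → X}
    (h : ∀ x, Finset.card {r | u r = x} = Finset.card {r | v r = x}) :
    ∃ σ : Equiv.Perm (Fin d), v = u ∘ σ := by
  have e : ∀ x, Nonempty ({r // v r = x} ≃ {r // u r = x}) := fun x =>
    ⟨Fintype.equivOfCardEq (by rw [Fintype.card_subtype, Fintype.card_subtype, h])⟩
  exact ⟨Equiv.ofFiberEquiv fun x => (e x).some,
    funext fun r => (Equiv.ofFiberEquiv_map (fun x => (e x).some) r).symm⟩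

theorem exists_card_fiber_eq {X : Type*} [DecidableEq X] [Fintype X] (M : X → ℕ)
    (hM : ∑ x, M x = d) : ∃ u : Fin d → X, ∀ x, Finset.card {r | u r = x} = M x := by
  have e : (Σ x, Fin (M x)) ≃ Fin d := Fintype.equivOfCardEq (by simp [hM])
  refine ⟨fun r => (e.symm r).1, fun x => ?_⟩
  rw [← Fintype.card_subtype, ← Fintype.card_fin (M x)]
  exact Fintype.card_congr ((e.symm.subtypeEquiv (q := fun z => z.1 = x) fun r => Iff.rfl).trans
    (Equiv.sigmaSubtype x))

/-- The letter through which the pair of letters `p` passes if the pairs in `s` are changed last;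
this is the letterwise version of `midWord`. -/
def midLetter (s : Finset (Fin n × Fin n)) (p : Fin n × Fin n) : Fin n :=
  if p ∈ s then p.2 else p.1

/-- The orbit invariant of a pair of words: the weight of the intermediate word and the number of
occurrences of each pair of distinct letters. -/
def pairType (s : Finset (Fin n × Fin n)) (i j : Word n d) :
    Comp n d × (Fin n × Fin n → ℕ) :=
  (⟨weight (midWord s i j), sum_weight _⟩, fun p => if p.1 = p.2 then 0 else pairCount i j p)

/-- The possible orbit invariants. -/
def pairTypes (s : Finset (Fin n × Fin n)) (d : ℕ) : Set (Comp n d × (Fin n × Fin n → ℕ)) :=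
  {q | (∀ a, q.2 (a, a) = 0) ∧ ∀ a, ∑ p with midLetter s p = a, q.2 p ≤ q.1.1 a}

section Orbits

variable (s : Finset (Fin n × Fin n))

theorem sum_pairCount_midLetter (i j : Word n d) (a : Fin n) :
    ∑ p with midLetter s p = a, pairCount i j p = weight (midWord s i j) a := by
  rw [sum_pairCount, weight]
  congr 1
  ext r
  rw [Finset.mem_filter, Finset.mem_filter, Finset.mem_filter, midLetter, midWord]
  simp

theorem sum_midLetter_eq_add (M : Fin n × Fin n → ℕ) (a : Fin n) :
    ∑ p with midLetter s p = a, M p =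
      M (a, a) + ∑ p with midLetter s p = a, if p.1 = p.2 then 0 else M p := by
  have h : ∀ p ∈ ({p | midLetter s p = a} : Finset (Fin n × Fin n)),
      M p = (if p = (a, a) then M (a, a) else 0) + if p.1 = p.2 then 0 else M p := by
    rintro ⟨b, c⟩ hp
    rw [Finset.mem_filter, midLetter] at hp
    replace hp := hp.2
    by_cases hbc : b = c
    · subst hbc
      have : b = a := by simpa using hp
      subst this
      simp
    · have : (b, c) ≠ (a, a) := fun h => hbc
        ((congrArg Prod.fst h).trans (congrArg Prod.snd h).symm)
      simp [this, hbc]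
  rw [Finset.sum_congr rfl h, Finset.sum_add_distrib, Finset.sum_ite_eq', if_pos]
  rw [Finset.mem_filter, midLetter]
  simp

theorem pairType_mem (i j : Word n d) : pairType s i j ∈ pairTypes s d := by
  refine ⟨fun a => by simp [pairType], fun a => ?_⟩
  simp only [pairType]
  rw [← sum_pairCount_midLetter, sum_midLetter_eq_add s (pairCount i j)]
  exact Nat.le_add_left _ _

/-- Pairs of words with the same invariant lie in the same orbit: the number of places at which both
words have the letter `a` can be read off from the weight of the intermediate word. -/
theorem exists_perm_of_pairType_eq {i j i' j' : Word n d} (h : pairType s i j = pairType s i' j') :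
    ∃ σ : Equiv.Perm (Fin d), i' = i ∘ σ ∧ j' = j ∘ σ := by
  obtain ⟨hw, hm⟩ := Prod.ext_iff.1 h
  have hw : weight (midWord s i j) = weight (midWord s i' j') := congrArg Subtype.val hw
  have hc : ∀ p, pairCount i j p = pairCount i' j' p := by
    rintro ⟨a, b⟩
    by_cases hab : a = b
    · subst hab
      have h1 := sum_midLetter_eq_add s (pairCount i j) a
      have h2 := sum_midLetter_eq_add s (pairCount i' j') a
      rw [sum_pairCount_midLetter] at h1 h2
      have h3 : ∑ p with midLetter s p = a, (if p.1 = p.2 then 0 else pairCount i j p) =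
          ∑ p with midLetter s p = a, if p.1 = p.2 then 0 else pairCount i' j' p :=
        Finset.sum_congr rfl fun p _ => congrFun hm p
      rw [hw] at h1
      omega
    · simpa [pairType, hab] using congrFun hm (a, b)
  obtain ⟨σ, hσ⟩ := exists_perm_of_card_fiber_eq hc
  exact ⟨σ, funext fun r => congrArg Prod.fst (congrFun hσ r),
    funext fun r => congrArg Prod.snd (congrFun hσ r)⟩

/-- Every possible orbit invariant is attained. -/
theorem exists_pairType_eq {q : Comp n d × (Fin n × Fin n → ℕ)} (hq : q ∈ pairTypes s d) :
    ∃ i j, pairType s i j = q := by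
  obtain ⟨⟨l, hl⟩, m⟩ := q
  obtain ⟨h0, hle⟩ := hq
  simp only at h0 hle
  -- The number of places at which both words have the letter `a` is what the weight leaves over.
  let M : Fin n × Fin n → ℕ := fun p =>
    if p.1 = p.2 then l p.1 - ∑ p' with midLetter s p' = p.1, m p' else m p
  have hMm : ∀ p, (if p.1 = p.2 then 0 else M p) = m p := by
    rintro ⟨a, b⟩
    by_cases hab : a = b
    · subst hab; simp [h0]
    · simp [M, hab]
  have hMl : ∀ a, ∑ p with midLetter s p = a, M p = l a := by
    intro a
    rw [sum_midLetter_eq_add s M, Finset.sum_congr rfl fun p _ => hMm p]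
    simp only [M, if_true]
    exact Nat.sub_add_cancel (hle a)
  have hMd : ∑ p, M p = d := by
    rw [← hl, ← Finset.sum_congr rfl fun a _ => hMl a]
    exact (Finset.sum_fiberwise _ _ _).symm
  obtain ⟨u, hu⟩ := exists_card_fiber_eq M hMd
  have hu' : ∀ p, pairCount (fun r => (u r).1) (fun r => (u r).2) p = M p := hu
  refine ⟨fun r => (u r).1, fun r => (u r).2, Prod.ext (Subtype.ext (funext fun a => ?_))
    (funext fun p => ?_)⟩
  · simp only [pairType]
    rw [← sum_pairCount_midLetter, Finset.sum_congr rfl fun p _ => hu' p, hMl]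
  · simp only [pairType]
    rw [hu', hMm]

end Orbits

/-- Products `X₁ 1_λ X₂`, in which `X₁` and `X₂` have complementary leading terms, form a basis of
the integral Schur algebra if their indices correspond to the orbits of pairs of words. -/
theorem exists_basis_of_leading {ι : Type*} {s₁ s₂ : Finset (Fin n × Fin n)}
    (hd : Disjoint s₁ s₂) (hs : ∀ p, p ∈ s₁ ∪ s₂ ↔ p.1 ≠ p.2)
    (φ : ι → Comp n d × (Fin n × Fin n → ℕ)) (hφ : Function.Injective φ)
    (hφr : Set.range φ = pairTypes s₁ d) (y : ι → schurAlgebra ℚ n d)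
    (hint : ∀ p, y p ∈ integralSchur n d)
    (X₁ X₂ : ι → Matrix (Word n d) (Word n d) ℚ)
    (hX₁ : ∀ p, Leading (X₁ p) s₁ (φ p).2) (hX₂ : ∀ p, Leading (X₂ p) s₂ (φ p).2)
    (hy : ∀ p, toWordMatrix n d (y p) = X₁ p * weightMatrix n d (φ p).1.1 * X₂ p) :
    ∃ b : Module.Basis ι ℤ (integralSchur n d), ∀ p, (b p : schurAlgebra ℚ n d) = y p := by
  classical
  have h₁ : ∀ p ∈ s₁, p.1 ≠ p.2 := fun p hp => (hs p).1 (Finset.mem_union_left _ hp)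
  have h₂ : ∀ p ∈ s₂, p.1 ≠ p.2 := fun p hp => (hs p).1 (Finset.mem_union_right _ hp)
  have hτ : ∀ i j : Word n d, ∃ p, φ p = pairType s₁ i j := fun i j => by
    have := pairType_mem s₁ i j
    rwa [← hφr] at this
  choose τ hτ using hτ
  have hmem : ∀ p, φ p ∈ pairTypes s₁ d := fun p => hφr ▸ Set.mem_range_self p
  have hmatch : ∀ p i j, (Matches (s₁ ∪ s₂) (φ p).2 i j ∧
      weight (midWord s₁ i j) = (φ p).1.1) ↔ τ i j = p := by
    intro p i j
    rw [← hφ.eq_iff, hτ, pairType, Prod.ext_iff, Subtype.ext_iff, and_comm]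
    refine and_congr_right fun _ => ⟨fun h => funext fun q => ?_, fun h => ⟨fun q hq => ?_, ?_⟩⟩
    · obtain ⟨a, b⟩ := q
      by_cases hab : a = b
      · subst hab; simp [(hmem p).1 a]
      · simpa [hab] using h.1 (a, b) ((hs _).2 hab)
    · rw [← h]
      simp [(hs q).1 hq]
    · exact fun r hr => (hs _).2 hr
  refine exists_basis_of_unitriangular y (fun p => ∑ q ∈ s₁ ∪ s₂, (φ p).2 q) τ hint ?_ ?_ ?_ ?_
  · intro i j
    exact (((hmatch _ i j).2 rfl).1.hammingDist_eq fun q hq => (hs q).1 hq).symm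
  · intro p i j hp
    simp only [Finset.sum_union hd] at hp
    rw [hy, weightMatrix, (hX₁ p).mul_diagonal_mul (hX₂ p) h₁ h₂ hd _ hp, ← ite_and]
    exact if_congr (hmatch p i j) rfl rfl
  · intro p
    obtain ⟨i, j, hij⟩ := exists_pairType_eq s₁ (hmem p)
    exact ⟨i, j, hφ (by rw [hτ, hij])⟩
  · intro i j i' j' h
    refine exists_perm_of_pairType_eq s₁ ?_
    rw [← hτ, ← hτ, h]

/-! ### Generating functions of divided powers -/

section TensorPower

variable {K : Type*} [CommRing K]

/-- The matrix, with respect to words, of the `d`-th tensor power of the linear map with matrix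
`g`. -/
def tensorPowerMatrix (d : ℕ) (g : Matrix (Fin n) (Fin n) K) :
    Matrix (Word n d) (Word n d) K :=
  Matrix.of fun i j => ∏ r, g (i r) (j r)

theorem tensorPowerMatrix_apply (g : Matrix (Fin n) (Fin n) K) (i j : Word n d) :
    tensorPowerMatrix d g i j = ∏ r, g (i r) (j r) := rfl

theorem tensorPowerMatrix_mul (g h : Matrix (Fin n) (Fin n) K) :
    tensorPowerMatrix d (g * h) = tensorPowerMatrix d g * tensorPowerMatrix d h := by
  ext i j
  simp only [Matrix.mul_apply, tensorPowerMatrix_apply, ← Finset.prod_mul_distrib]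
  exact Fintype.prod_sum fun r a => g (i r) a * h a (j r)

theorem tensorPowerMatrix_diagonal (g : Fin n → K) :
    tensorPowerMatrix d (Matrix.diagonal g) = Matrix.diagonal fun w => ∏ r, g (w r) := by
  ext i j
  rw [tensorPowerMatrix_apply, Matrix.diagonal_apply]
  split_ifs with h
  · simp [h]
  · obtain ⟨r, hr⟩ := Function.ne_iff.1 h
    exact Finset.prod_eq_zero (Finset.mem_univ r) (Matrix.diagonal_apply_ne _ hr)

theorem tensorPowerMatrix_transvection_apply {a b : Fin n} (hab : a ≠ b) (φ : K)
    (i j : Word n d) :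
    tensorPowerMatrix d (Matrix.transvection a b φ) i j =
      if ∀ r, i r = j r ∨ (i r = a ∧ j r = b) then φ ^ hammingDist i j else 0 := by
  have key : ∀ x y : Fin n, Matrix.transvection a b φ x y =
      if x = y ∨ (x = a ∧ y = b) then (if x ≠ y then φ else 1) else 0 := by
    intro x y
    by_cases hxy : x = y
    · subst hxy
      have : ¬ (a = x ∧ b = x) := fun h => hab (h.1.trans h.2.symm)
      simp [Matrix.transvection, this]
    · by_cases h : x = a ∧ y = b
      · obtain ⟨rfl, rfl⟩ := h
        simp [Matrix.transvection, hxy]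
      · have h' : ¬ (a = x ∧ b = y) := fun h' => h ⟨h'.1.symm, h'.2.symm⟩
        simp [Matrix.transvection, hxy, h, h']
  rw [tensorPowerMatrix_apply, Finset.prod_congr rfl fun r _ => key (i r) (j r),
    Fintype.prod_ite_zero]
  congr 1
  rw [← Finset.prod_filter, Finset.prod_const]
  rfl

/-- Tensor powers of transvections are generating functions of divided powers. -/
theorem tensorPowerMatrix_transvection [Algebra ℚ K] {a b : Fin n} (hab : a ≠ b) (φ : K) :
    tensorPowerMatrix d (Matrix.transvection a b φ) =
      ∑ m ∈ Finset.range (d + 1), φ ^ m • (moveMatrix n d a b m).map (algebraMap ℚ K) := by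
  ext i j
  rw [tensorPowerMatrix_transvection_apply hab, Matrix.sum_apply]
  simp only [Matrix.smul_apply, Matrix.map_apply, moveMatrix_apply, smul_eq_mul]
  split_ifs with h
  · have hd : hammingDist i j < d + 1 := by
      simpa [Nat.lt_succ_iff] using hammingDist_le_card_fintype (x := i) (y := j)
    rw [Finset.sum_eq_single (hammingDist i j)]
    · rw [if_pos ⟨h, rfl⟩, map_one, mul_one]
    · intro m _ hm
      simp [hm.symm]
    · exact fun h' => absurd (Finset.mem_range.2 hd) h'
  · exact (Finset.sum_eq_zero fun m _ => by simp [h]).symm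

end TensorPower

section Torus

variable {K : Type*} [CommRing K]

open Matrix in
theorem transvection_commutator {a b c : Fin n} (hab : a ≠ b) (hbc : b ≠ c) (hac : a ≠ c) (s : K) :
    transvection a b s * (transvection b c 1 * (transvection a b (-s) * transvection b c (-1))) =
      transvection a c s := by
  simp only [transvection, mul_add, add_mul, one_mul, mul_one, single_mul_single_same,
    single_mul_single_of_ne _ _ _ _ hab.symm, single_mul_single_of_ne _ _ _ _ hbc.symm,
    single_mul_single_of_ne _ _ _ _ hac.symm, add_zero, mul_neg, neg_mul,
    ← Matrix.single_neg]
  abel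

open Matrix in
/-- The torus element with entries `s` and `s⁻¹` as a product of transvections. -/
theorem torus_eq_prod_transvection {a b : Fin n} (hab : a ≠ b) {s t : K} (hst : s * t = 1) :
    transvection a b s * (transvection b a (-t) * (transvection a b s *
      (transvection a b (-1) * (transvection b a 1 * transvection a b (-1))))) =
      diagonal fun x => if x = a then s else if x = b then t else 1 := by
  -- Both halves of the product represent the simple reflection: they have the form `w(s)` and
  -- `w(-1)`, and the torus element is `w(s) w(-1)`.
  have hw : ∀ s t : K, s * t = 1 →
      transvection a b s * (transvection b a (-t) * transvection a b s) =
        1 - single a a 1 - single b b 1 + single a b s - single b a t := by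
    intro s t hst
    have hts : t * s = 1 := by rw [mul_comm, hst]
    simp only [transvection, mul_add, add_mul, one_mul, mul_one, single_mul_single_same,
      single_mul_single_of_ne _ _ _ _ hab.symm, add_zero, mul_neg, neg_mul, hst, hts,
      ← Matrix.single_neg]
    abel
  have h1 := hw s t hst
  have h2 := hw (-1) (-1) (by simp)
  rw [neg_neg] at h2
  rw [h2, ← mul_assoc (transvection b a (-t)), ← mul_assoc, h1]
  simp only [mul_add, add_mul, mul_sub, sub_mul, one_mul, mul_one, single_mul_single_same,
      single_mul_single_of_ne _ _ _ _ hab.symm, single_mul_single_of_ne _ _ _ _ hab, add_zero,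
      sub_zero, mul_neg]
  ext x y
  by_cases hxy : x = y
  · subst hxy
    by_cases hxa : x = a
    · subst hxa; simp [hab.symm]
    · by_cases hxb : x = b
      · subst hxb; simp [hab, hab.symm]
      · simp [hxa, hxb, Ne.symm hxa, Ne.symm hxb]
  · simp only [Matrix.add_apply, Matrix.sub_apply, Matrix.single_apply,
      Matrix.one_apply_ne hxy, Matrix.diagonal_apply_ne _ hxy]
    by_cases hxa : a = x <;> by_cases hyb : b = y <;> by_cases hxb : b = x <;>
      by_cases hya : a = y <;> simp_all

end Torus

/-! ### Coefficients of generating functions -/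

section Coefficients

open LaurentPolynomial

variable (V : Subring (Matrix (Word n d) (Word n d) ℚ))

/-- All coefficients of a matrix of Laurent polynomials lie in `V`. -/
def HasCoeffsIn (G : Matrix (Word n d) (Word n d) ℚ[T;T⁻¹]) : Prop :=
  ∀ k : ℤ, (G.map fun p => p.coeff k) ∈ V

/-- The tensor power of `g` preserves the matrices with coefficients in `V`. -/
def PreservesCoeffs (g : Matrix (Fin n) (Fin n) ℚ[T;T⁻¹]) : Prop :=
  ∀ G, HasCoeffsIn V G → HasCoeffsIn V (tensorPowerMatrix d g * G)

variable {V}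

theorem HasCoeffsIn.one : HasCoeffsIn V 1 := by
  intro k
  have : ((1 : Matrix (Word n d) (Word n d) ℚ[T;T⁻¹]).map fun p => p.coeff k) =
      if k = 0 then 1 else 0 := by
    ext i j
    rw [Matrix.map_apply, Matrix.one_apply]
    have h1 : (1 : ℚ[T;T⁻¹]).coeff k = if k = 0 then 1 else 0 := by
      rw [← T_zero, T_apply]
      exact if_congr eq_comm rfl rfl
    by_cases hk : k = 0 <;> by_cases hij : i = j <;> simp [hk, hij, h1, Matrix.one_apply]
  rw [this]
  split_ifs
  exacts [one_mem _, zero_mem _]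

theorem HasCoeffsIn.sum {α : Type*} (s : Finset α)
    {G : α → Matrix (Word n d) (Word n d) ℚ[T;T⁻¹]} (h : ∀ a ∈ s, HasCoeffsIn V (G a)) :
    HasCoeffsIn V (∑ a ∈ s, G a) := by
  intro k
  have : ((∑ a ∈ s, G a).map fun p => p.coeff k) = ∑ a ∈ s, (G a).map fun p => p.coeff k := by
    ext i j
    simp [Matrix.sum_apply]
  rw [this]
  exact sum_mem fun a ha => h a ha k

theorem HasCoeffsIn.single_smul_mul {A : Matrix (Word n d) (Word n d) ℚ} (hA : A ∈ V) (l c : ℤ)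
    {G : Matrix (Word n d) (Word n d) ℚ[T;T⁻¹]} (hG : HasCoeffsIn V G) :
    HasCoeffsIn V ((AddMonoidAlgebra.single l (c : ℚ) : ℚ[T;T⁻¹]) •
      A.map (algebraMap ℚ ℚ[T;T⁻¹]) * G) := by
  intro k
  have : (((AddMonoidAlgebra.single l (c : ℚ) : ℚ[T;T⁻¹]) •
      A.map (algebraMap ℚ ℚ[T;T⁻¹]) * G).map fun p => p.coeff k) =
        c • (A * G.map fun p => p.coeff (-l + k)) := by
    ext i j
    simp only [Matrix.map_apply, Matrix.mul_apply, Matrix.smul_apply, smul_eq_mul,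
      zsmul_eq_mul, ← C_eq_algebraMap, ← single_eq_C, AddMonoidAlgebra.single_mul_single, add_zero,
      AddMonoidAlgebra.coeff_sum, Finsupp.finsetSum_apply,
      AddMonoidAlgebra.coeff_single_mul_apply, Finset.mul_sum, mul_assoc]
  rw [this]
  exact zsmul_mem (mul_mem hA (hG _)) c

theorem PreservesCoeffs.hasCoeffsIn {g : Matrix (Fin n) (Fin n) ℚ[T;T⁻¹]}
    (hg : PreservesCoeffs V g) : HasCoeffsIn V (tensorPowerMatrix d g) := by
  simpa using hg 1 HasCoeffsIn.one

theorem PreservesCoeffs.mul {g h : Matrix (Fin n) (Fin n) ℚ[T;T⁻¹]}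
    (hg : PreservesCoeffs V g) (hh : PreservesCoeffs V h) : PreservesCoeffs V (g * h) := by
  intro G hG
  rw [tensorPowerMatrix_mul, mul_assoc]
  exact hg _ (hh _ hG)

theorem PreservesCoeffs.transvection {a b : Fin n} (hab : a ≠ b)
    (hV : ∀ m, moveMatrix n d a b m ∈ V) (l c : ℤ) :
    PreservesCoeffs V (Matrix.transvection a b (AddMonoidAlgebra.single l (c : ℚ))) := by
  intro G hG
  rw [tensorPowerMatrix_transvection hab, Finset.sum_mul]
  refine HasCoeffsIn.sum _ fun m _ => ?_
  rw [AddMonoidAlgebra.single_pow, ← Int.cast_pow]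
  exact HasCoeffsIn.single_smul_mul (hV m) _ _ hG

/-- The divided powers for the pairs `(a, b)` and `(b, c)` generate those for `(a, c)`: compare
coefficients in the commutator formula for transvections. -/
theorem moveMatrix_mem_trans {a b c : Fin n} (hab : a ≠ b) (hbc : b ≠ c) (hac : a ≠ c)
    (h₁ : ∀ m, moveMatrix n d a b m ∈ V) (h₂ : ∀ m, moveMatrix n d b c m ∈ V) (m : ℕ) :
    moveMatrix n d a c m ∈ V := by
  have h := transvection_commutator hab hbc hac (T 1 : ℚ[T;T⁻¹])
  have hT : ∀ c : ℤ, PreservesCoeffs V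
      (Matrix.transvection a b (AddMonoidAlgebra.single 1 (c : ℚ))) :=
    PreservesCoeffs.transvection hab h₁ 1
  have hO : ∀ c' : ℤ, PreservesCoeffs V
      (Matrix.transvection b c (AddMonoidAlgebra.single 0 (c' : ℚ))) :=
    PreservesCoeffs.transvection hbc h₂ 0
  have e1 : (AddMonoidAlgebra.single 1 ((1 : ℤ) : ℚ) : ℚ[T;T⁻¹]) = T 1 := by rw [Int.cast_one]; rfl
  have e2 : (AddMonoidAlgebra.single 1 ((-1 : ℤ) : ℚ) : ℚ[T;T⁻¹]) = -T 1 := by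
    rw [Int.cast_neg, AddMonoidAlgebra.single_neg, e1]
  have e3 : (AddMonoidAlgebra.single 0 ((1 : ℤ) : ℚ) : ℚ[T;T⁻¹]) = 1 := by rw [Int.cast_one]; rfl
  have e4 : (AddMonoidAlgebra.single 0 ((-1 : ℤ) : ℚ) : ℚ[T;T⁻¹]) = -1 := by
    rw [Int.cast_neg, AddMonoidAlgebra.single_neg, e3]
  have hG := ((hT 1).mul ((hO 1).mul ((hT (-1)).mul (hO (-1))))).hasCoeffsIn
  rw [e1, e2, e3, e4, h] at hG
  convert hG m using 1
  ext i j
  rw [Matrix.map_apply, tensorPowerMatrix_transvection_apply hac, moveMatrix_apply, ite_and]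
  split_ifs with _ h2
  · rw [T_pow, mul_one, T_apply, if_pos (by rw [h2])]
  · rw [T_pow, mul_one, T_apply, if_neg (by exact_mod_cast h2)]
  · rfl

/-- The projection onto the words with `weight a - weight b = c` is the coefficient of `T^c` in the
tensor power of a torus element. -/
theorem diagonal_weight_sub_mem {a b : Fin n} (hab : a ≠ b)
    (h₁ : ∀ m, moveMatrix n d a b m ∈ V) (h₂ : ∀ m, moveMatrix n d b a m ∈ V) (c : ℤ) :
    (Matrix.diagonal fun w : Word n d =>
      if (weight w a : ℤ) - weight w b = c then (1 : ℚ) else 0) ∈ V := by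
  have hst : (T 1 : ℚ[T;T⁻¹]) * T (-1) = 1 := by rw [← T_add, ← T_zero]; rfl
  have h := torus_eq_prod_transvection hab hst
  have hA := PreservesCoeffs.transvection (V := V) hab h₁
  have hB := PreservesCoeffs.transvection (V := V) hab.symm h₂
  have e1 : (AddMonoidAlgebra.single 1 ((1 : ℤ) : ℚ) : ℚ[T;T⁻¹]) = T 1 := by rw [Int.cast_one]; rfl
  have e2 : (AddMonoidAlgebra.single (-1) ((-1 : ℤ) : ℚ) : ℚ[T;T⁻¹]) = -T (-1) := by
    rw [Int.cast_neg, AddMonoidAlgebra.single_neg, Int.cast_one]; rfl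
  have e3 : (AddMonoidAlgebra.single 0 ((1 : ℤ) : ℚ) : ℚ[T;T⁻¹]) = 1 := by rw [Int.cast_one]; rfl
  have e4 : (AddMonoidAlgebra.single 0 ((-1 : ℤ) : ℚ) : ℚ[T;T⁻¹]) = -1 := by
    rw [Int.cast_neg, AddMonoidAlgebra.single_neg, e3]
  have hG := ((hA 1 1).mul ((hB (-1) (-1)).mul ((hA 1 1).mul ((hA 0 (-1)).mul
    ((hB 0 1).mul (hA 0 (-1))))))).hasCoeffsIn
  rw [e1, e2, e3, e4, h, tensorPowerMatrix_diagonal] at hG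
  have hprod : ∀ w : Word n d, (∏ r, if w r = a then (T 1 : ℚ[T;T⁻¹]) else
      if w r = b then T (-1) else 1) = T ((weight w a : ℤ) - weight w b) := by
    intro w
    have : ∀ x : Fin n, (if x = a then (T 1 : ℚ[T;T⁻¹]) else if x = b then T (-1) else 1) =
        (if x = a then T 1 else 1) * (if x = b then T (-1) else 1) := by
      intro x
      by_cases hx : x = a
      · subst hx; simp [hab]
      · simp [hx]
    rw [Finset.prod_congr rfl fun r _ => this (w r), Finset.prod_mul_distrib,
      ← Finset.prod_filter, ← Finset.prod_filter, Finset.prod_const, Finset.prod_const, T_pow,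
      T_pow, ← T_add]
    congr 1
    simp only [weight]
    ring
  convert hG c using 1
  ext i j
  rw [Matrix.map_apply, Matrix.diagonal_apply, Matrix.diagonal_apply]
  split_ifs with _ h2
  · rw [hprod, T_apply, if_pos h2]
  · rw [hprod, T_apply, if_neg h2]
  · rfl

end Coefficients

/-! ### Subrings containing the divided powers of the simple root vectors -/

section Generation

variable {V : Subring (Matrix (Word n d) (Word n d) ℚ)}

/-- A subring containing the divided powers of the simple root vectors contains those of all root
vectors, by induction on the height. -/
theorem moveMatrix_mem_of_simple
    (he : ∀ (i : ℕ) (h : i + 1 < n) (m : ℕ), moveMatrix n d ⟨i, by omega⟩ ⟨i + 1, h⟩ m ∈ V)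
    (hf : ∀ (i : ℕ) (h : i + 1 < n) (m : ℕ), moveMatrix n d ⟨i + 1, h⟩ ⟨i, by omega⟩ m ∈ V)
    {a b : Fin n} (hab : a ≠ b) (m : ℕ) : moveMatrix n d a b m ∈ V := by
  have hpos : ∀ (k i : ℕ) (h : i + k + 1 < n) (m : ℕ),
      moveMatrix n d ⟨i, by omega⟩ ⟨i + k + 1, h⟩ m ∈ V := by
    intro k
    induction k with
    | zero => exact fun i h m => he i h m
    | succ k ih =>
      intro i h m
      refine moveMatrix_mem_trans (b := ⟨i + k + 1, by omega⟩) ?_ ?_ ?_ (ih i (by omega))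
        (he (i + k + 1) h) m <;> simp only [ne_eq, Fin.mk.injEq] <;> omega
  have hneg : ∀ (k i : ℕ) (h : i + k + 1 < n) (m : ℕ),
      moveMatrix n d ⟨i + k + 1, h⟩ ⟨i, by omega⟩ m ∈ V := by
    intro k
    induction k with
    | zero => exact fun i h m => hf i h m
    | succ k ih =>
      intro i h m
      refine moveMatrix_mem_trans (b := ⟨i + k + 1, by omega⟩) ?_ ?_ ?_ (hf (i + k + 1) h)
        (ih i (by omega)) m <;> simp only [ne_eq, Fin.mk.injEq] <;> omega
  obtain ⟨a, ha⟩ := a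
  obtain ⟨b, hb⟩ := b
  rcases lt_trichotomy a b with h | h | h
  · obtain ⟨k, rfl⟩ := Nat.exists_eq_add_of_lt h
    exact hpos k a hb m
  · exact absurd (Fin.ext h) hab
  · obtain ⟨k, rfl⟩ := Nat.exists_eq_add_of_lt h
    exact hneg k b ha m

theorem weightMatrix_mem (hV : ∀ a b : Fin n, a ≠ b → ∀ m, moveMatrix n d a b m ∈ V)
    (l : Comp n d) : weightMatrix n d l.1 ∈ V := by
  cases n with
  | zero =>
    have : weightMatrix 0 d l.1 = 1 := by
      rw [weightMatrix, ← Matrix.diagonal_one]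
      exact congrArg _ (funext fun w => if_pos (Subsingleton.elim _ _))
    rw [this]
    exact one_mem _
  | succ n =>
    have key : ∀ t : Finset (Fin n), (Matrix.diagonal fun w : Word (n + 1) d =>
        if ∀ b ∈ t, (weight w 0 : ℤ) - weight w b.succ = l.1 0 - l.1 b.succ then (1 : ℚ) else 0)
          ∈ V := by
      intro t
      induction t using Finset.induction_on with
      | empty => simp
      | insert b t _ ih =>
        have hb : (0 : Fin (n + 1)) ≠ b.succ := (Fin.succ_ne_zero b).symm
        convert! mul_mem (diagonal_weight_sub_mem hb (hV _ _ hb) (hV _ _ hb.symm)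
          (l.1 0 - l.1 b.succ)) ih using 1
        rw [Matrix.diagonal_mul_diagonal]
        congr 1
        funext w
        simp only [Finset.forall_mem_insert, ite_and, ite_mul, one_mul, zero_mul]
    convert key Finset.univ using 1
    rw [weightMatrix]
    congr 1
    funext w
    refine if_congr ⟨fun h b _ => by rw [h], fun h => ?_⟩ rfl rfl
    -- All letters have the same excess over `l`, which vanishes because the sums agree.
    have hc : ∀ a : Fin (n + 1), (weight w a : ℤ) - l.1 a = weight w 0 - l.1 0 := by
      intro a
      refine Fin.cases rfl (fun b => ?_) a
      have := h b (Finset.mem_univ b)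
      omega
    have hsum : ∑ a, ((weight w a : ℤ) - l.1 a) = 0 := by
      rw [Finset.sum_sub_distrib, ← Nat.cast_sum, ← Nat.cast_sum, sum_weight, l.2, sub_self]
    rw [Finset.sum_congr rfl fun a _ => hc a, Finset.sum_const, Finset.card_univ, Fintype.card_fin,
      smul_eq_zero] at hsum
    have h0 := hsum.resolve_left (Nat.succ_ne_zero n)
    funext a
    have := hc a
    omega

end Generation

/-- The subring of `S(n,d)` generated by the divided powers of the `e_i` and `f_i`. -/
def dividedPowerSubring (n d : ℕ) : Subring (schurAlgebra ℚ n d) :=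
  Subring.closure
    {x | ∃ (i : Fin (n - 1)) (m : ℕ), x = dividedPower (e n d i) m ∨ x = dividedPower (f n d i) m}

theorem dividedPower_mem_integralSchur {a b : Fin n} (hab : a ≠ b) (m : ℕ) :
    dividedPower (unitAction n d a b) m ∈ integralSchur n d := by
  rw [mem_integralSchur_iff]
  intro i j
  rw [toWordMatrix_dividedPower hab, moveMatrix_apply]
  split_ifs
  exacts [⟨1, by simp⟩, ⟨0, by simp⟩]

theorem dividedPowerSubring_le : dividedPowerSubring n d ≤ integralSchur n d := by
  rw [dividedPowerSubring, Subring.closure_le]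
  rintro x ⟨i, m, rfl | rfl⟩
  · exact dividedPower_mem_integralSchur (by simp) m
  · exact dividedPower_mem_integralSchur (by simp) m

theorem mem_dividedPowerSubring_iff (F : schurAlgebra ℚ n d) :
    F ∈ dividedPowerSubring n d ↔
      toWordMatrix n d F ∈ (dividedPowerSubring n d).map (toWordMatrix n d).toRingHom := by
  rw [Subring.mem_map]
  exact ⟨fun h => ⟨F, h, rfl⟩, fun ⟨G, hG, h⟩ => toWordMatrix_injective h ▸ hG⟩

theorem moveMatrix_mem_map {a b : Fin n} (hab : a ≠ b) (m : ℕ) :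
    moveMatrix n d a b m ∈ (dividedPowerSubring n d).map (toWordMatrix n d).toRingHom := by
  refine moveMatrix_mem_of_simple (fun i h m => ?_) (fun i h m => ?_) hab m
  · rw [← toWordMatrix_dividedPower (by simp), ← mem_dividedPowerSubring_iff]
    exact Subring.subset_closure ⟨⟨i, by omega⟩, m, Or.inl rfl⟩
  · rw [← toWordMatrix_dividedPower (by simp), ← mem_dividedPowerSubring_iff]
    exact Subring.subset_closure ⟨⟨i, by omega⟩, m, Or.inr rfl⟩

theorem eval_idemMonomial_mem (l : Comp n d) :
    KostantMonomial.eval d (idemMonomial l.1) ∈ dividedPowerSubring n d := by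
  rw [mem_dividedPowerSubring_iff, toWordMatrix_idemMonomial]
  exact weightMatrix_mem (fun a b hab m => moveMatrix_mem_map hab m) l

theorem eval_root_mem (i j : Fin n) (hij : i ≠ j) (m : ℕ) :
    (KostantFactor.root i j hij m).eval d ∈ dividedPowerSubring n d := by
  rw [mem_dividedPowerSubring_iff, KostantFactor.eval, rootVector_eq, toWordMatrix_dividedPower hij]
  exact moveMatrix_mem_map hij m

theorem eval_eMonomial_mem (l : List (PosRoot n)) (A : PosRoot n → ℕ) :
    KostantMonomial.eval d (eMonomial l A) ∈ dividedPowerSubring n d := by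
  refine Subring.list_prod_mem _ fun x hx => ?_
  simp only [eMonomial, List.map_map, List.mem_map, Function.comp_apply] at hx
  obtain ⟨α, -, rfl⟩ := hx
  exact eval_root_mem _ _ _ _

theorem eval_fMonomial_mem (l : List (PosRoot n)) (C : PosRoot n → ℕ) :
    KostantMonomial.eval d (fMonomial l C) ∈ dividedPowerSubring n d := by
  refine Subring.list_prod_mem _ fun x hx => ?_
  simp only [fMonomial, List.map_map, List.mem_map, Function.comp_apply] at hx
  obtain ⟨α, -, rfl⟩ := hx
  exact eval_root_mem _ _ _ _

theorem eval_append (M N : KostantMonomial n) :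
    KostantMonomial.eval d (M ++ N) = KostantMonomial.eval d M * KostantMonomial.eval d N := by
  simp [KostantMonomial.eval]

theorem yPlus_mem (le lf : List (PosRoot n)) (p : IndexPlus n d le lf) :
    yPlus n d le lf p ∈ dividedPowerSubring n d := by
  rw [yPlus, eval_append, eval_append]
  exact mul_mem (mul_mem (eval_eMonomial_mem _ _) (eval_idemMonomial_mem _))
    (eval_fMonomial_mem _ _)

theorem yMinus_mem (le lf : List (PosRoot n)) (p : IndexMinus n d le lf) :
    yMinus n d le lf p ∈ dividedPowerSubring n d := by
  rw [yMinus, eval_append, eval_append]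
  exact mul_mem (mul_mem (eval_fMonomial_mem _ _) (eval_idemMonomial_mem _))
    (eval_eMonomial_mem _ _)

/-! ### Indices and contents -/

/-- The exponents `A` at the pairs `(i, j)` with `i < j` and `C` at the opposite pairs, as one
function on pairs of letters. -/
def joinExponents (A C : PosRoot n → ℕ) (p : Fin n × Fin n) : ℕ :=
  if h : p.1 < p.2 then A ⟨p, h⟩ else if h : p.2 < p.1 then C ⟨(p.2, p.1), h⟩ else 0

theorem joinExponents_pos (A C : PosRoot n → ℕ) (α : PosRoot n) : joinExponents A C α.1 = A α :=
  dif_pos α.2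

theorem joinExponents_neg (A C : PosRoot n → ℕ) (α : PosRoot n) :
    joinExponents A C (α.1.2, α.1.1) = C α := by
  have h : α.1.1 < α.1.2 := α.2
  rw [joinExponents, dif_neg h.not_gt, dif_pos h]

theorem joinExponents_diag (A C : PosRoot n → ℕ) (a : Fin n) : joinExponents A C (a, a) = 0 := by
  simp [joinExponents]

theorem joinExponents_injective {A C A' C' : PosRoot n → ℕ}
    (h : joinExponents A C = joinExponents A' C') : A = A' ∧ C = C' := by
  refine ⟨funext fun α => ?_, funext fun α => ?_⟩
  · rw [← joinExponents_pos A C, h, joinExponents_pos]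
  · rw [← joinExponents_neg A C, h, joinExponents_neg]

theorem joinExponents_restrict {m : Fin n × Fin n → ℕ} (hm : ∀ a, m (a, a) = 0) :
    joinExponents (fun α => m α.1) (fun α => m (α.1.2, α.1.1)) = m := by
  funext ⟨a, b⟩
  rcases lt_trichotomy a b with h | rfl | h
  · exact joinExponents_pos _ _ ⟨(a, b), h⟩
  · rw [joinExponents_diag, hm]
  · exact joinExponents_neg _ _ ⟨(b, a), h⟩

/-- The pairs of letters belonging to the positive roots. -/
def posPairs (n : ℕ) : Finset (Fin n × Fin n) := Finset.univ.filter fun p => p.1 < p.2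

/-- The pairs of letters belonging to the negative roots. -/
def negPairs (n : ℕ) : Finset (Fin n × Fin n) := Finset.univ.filter fun p => p.2 < p.1

theorem mem_posPairs {p : Fin n × Fin n} : p ∈ posPairs n ↔ p.1 < p.2 := by simp [posPairs]

theorem mem_negPairs {p : Fin n × Fin n} : p ∈ negPairs n ↔ p.2 < p.1 := by simp [negPairs]

theorem disjoint_posPairs_negPairs : Disjoint (posPairs n) (negPairs n) :=
  Finset.disjoint_left.2 fun _ h h' => (mem_posPairs.1 h).asymm (mem_negPairs.1 h')

theorem sum_joinExponents_midLetter (s : Finset (Fin n × Fin n)) (A C : PosRoot n → ℕ)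
    (a : Fin n) :
    ∑ p with midLetter s p = a, joinExponents A C p =
      ∑ α : PosRoot n, ((if midLetter s α.1 = a then A α else 0) +
        if midLetter s (α.1.2, α.1.1) = a then C α else 0) := by
  have h : ∀ p, (if midLetter s p = a then joinExponents A C p else 0) =
      (if p.1 < p.2 then (if midLetter s p = a then joinExponents A C p else 0) else 0) +
        if p.2 < p.1 then (if midLetter s p = a then joinExponents A C p else 0) else 0 := by
    rintro ⟨b, c⟩
    rcases lt_trichotomy b c with h | rfl | h
    · simp [h, h.not_gt]
    · simp [joinExponents_diag]
    · simp [h, h.not_gt]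
  rw [Finset.sum_filter, Finset.sum_congr rfl fun p _ => h p, Finset.sum_add_distrib,
    Finset.sum_add_distrib]
  have hs : ∀ F : Fin n × Fin n → ℕ,
      ∑ p, (if p.1 < p.2 then F p else 0) = ∑ α : PosRoot n, F α.1 := fun F => by
    rw [← Finset.sum_filter]
    exact Finset.sum_subtype _ (fun p => by simp) F
  congr 1
  · rw [hs]
    exact Finset.sum_congr rfl fun α _ => by rw [joinExponents_pos]
  · rw [← (Equiv.prodComm (Fin n) (Fin n)).sum_comp]
    refine (hs fun p => if midLetter s p.swap = a then joinExponents A C p.swap else 0).trans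
      (Finset.sum_congr rfl fun α _ => ?_)
    rw [← joinExponents_neg A C α]
    rfl

theorem sum_map_single_apply {l : List (PosRoot n)} (hl : l.Nodup ∧ ∀ α, α ∈ l)
    (g : PosRoot n → Fin n) (A : PosRoot n → ℕ) (a : Fin n) :
    (l.map fun α => (Pi.single (g α) (A α) : Fin n → ℕ)).sum a =
      ∑ α, if g α = a then A α else 0 := by
  have hu : l.toFinset = Finset.univ := Finset.eq_univ_of_forall fun α => by simp [hl.2 α]
  rw [← List.sum_toFinset _ hl.1, hu, Finset.sum_apply]
  refine Finset.sum_congr rfl fun α _ => ?_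
  rw [Pi.single_apply]
  exact if_congr eq_comm rfl rfl

/-- The content counts pairs of letters by their intermediate letter, which is their maximum if the
positive pairs are changed last. -/
theorem content_apply {le lf : List (PosRoot n)} (hle : le.Nodup ∧ ∀ α, α ∈ le)
    (hlf : lf.Nodup ∧ ∀ α, α ∈ lf) (A C : PosRoot n → ℕ) (a : Fin n) :
    KostantMonomial.content (eMonomial le A ++ fMonomial lf C) a =
      ∑ p with midLetter (posPairs n) p = a, joinExponents A C p := by
  rw [sum_joinExponents_midLetter, Finset.sum_add_distrib, KostantMonomial.content, List.map_append,
    List.sum_append, Pi.add_apply, eMonomial, fMonomial, List.map_map, List.map_map]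
  refine congrArg₂ _ ((sum_map_single_apply hle (fun α => max α.1.1 α.1.2) A a).trans ?_)
    ((sum_map_single_apply hlf (fun α => max α.1.2 α.1.1) C a).trans ?_)
  · refine Finset.sum_congr rfl fun α _ => ?_
    rw [midLetter, if_pos (mem_posPairs.2 α.2), max_eq_right α.2.le]
  · refine Finset.sum_congr rfl fun α _ => ?_
    rw [midLetter, if_neg fun h => α.2.asymm (mem_posPairs.1 h), max_eq_left α.2.le]

theorem mirrorContent_apply {le lf : List (PosRoot n)} (hle : le.Nodup ∧ ∀ α, α ∈ le)
    (hlf : lf.Nodup ∧ ∀ α, α ∈ lf) (A C : PosRoot n → ℕ) (a : Fin n) :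
    KostantMonomial.mirrorContent (fMonomial lf A ++ eMonomial le C) a =
      ∑ p with midLetter (negPairs n) p = a, joinExponents C A p := by
  rw [sum_joinExponents_midLetter, Finset.sum_add_distrib, KostantMonomial.mirrorContent,
    List.map_append, List.sum_append, Pi.add_apply, eMonomial, fMonomial, List.map_map,
    List.map_map, add_comm]
  refine congrArg₂ _ ((sum_map_single_apply hle (fun α => min α.1.1 α.1.2) C a).trans ?_)
    ((sum_map_single_apply hlf (fun α => min α.1.2 α.1.1) A a).trans ?_)
  · refine Finset.sum_congr rfl fun α _ => ?_
    rw [midLetter, if_neg fun h => α.2.asymm (mem_negPairs.1 h), min_eq_left α.2.le]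
  · refine Finset.sum_congr rfl fun α _ => ?_
    rw [midLetter, if_pos (mem_negPairs.2 α.2), min_eq_right α.2.le]

theorem leading_eMonomial {l : List (PosRoot n)} (hl : l.Nodup ∧ ∀ α, α ∈ l)
    (A C : PosRoot n → ℕ) :
    Leading (toWordMatrix n d (KostantMonomial.eval d (eMonomial l A))) (posPairs n)
      (joinExponents A C) := by
  have h := Leading.list_prod (d := d) (joinExponents A C) (l.map Subtype.val)
    (hl.1.map Subtype.val_injective) (by
      simp only [List.mem_map]
      rintro _ ⟨α, -, rfl⟩
      exact α.2.ne)
  convert! h using 1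
  · rw [KostantMonomial.eval, eMonomial, map_list_prod, List.map_map, List.map_map, List.map_map]
    congr 2
    funext α
    simp only [Function.comp_apply, KostantFactor.eval]
    rw [rootVector_eq, toWordMatrix_dividedPower α.2.ne, joinExponents_pos]
  · ext p
    rw [mem_posPairs, List.mem_toFinset, List.mem_map]
    exact ⟨fun hp => ⟨⟨p, hp⟩, hl.2 _, rfl⟩, fun ⟨α, _, hα⟩ => hα ▸ α.2⟩

theorem leading_fMonomial {l : List (PosRoot n)} (hl : l.Nodup ∧ ∀ α, α ∈ l)
    (A C : PosRoot n → ℕ) :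
    Leading (toWordMatrix n d (KostantMonomial.eval d (fMonomial l C))) (negPairs n)
      (joinExponents A C) := by
  have h := Leading.list_prod (d := d) (joinExponents A C) (l.map fun α => (α.1.2, α.1.1))
    (hl.1.map fun α β h => Subtype.ext (Prod.swap_injective h)) (by
      simp only [List.mem_map]
      rintro _ ⟨α, -, rfl⟩
      exact α.2.ne')
  convert! h using 1
  · rw [KostantMonomial.eval, fMonomial, map_list_prod, List.map_map, List.map_map, List.map_map]
    congr 2
    funext α
    simp only [Function.comp_apply, KostantFactor.eval]
    rw [rootVector_eq, toWordMatrix_dividedPower α.2.ne', joinExponents_neg]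
  · ext p
    rw [mem_negPairs, List.mem_toFinset, List.mem_map]
    exact ⟨fun hp => ⟨⟨(p.2, p.1), hp⟩, hl.2 _, rfl⟩, fun ⟨α, _, hα⟩ => hα ▸ α.2⟩

/-! ### The two bases -/

theorem exists_basis_yPlus {le lf : List (PosRoot n)} (hle : le.Nodup ∧ ∀ α, α ∈ le)
    (hlf : lf.Nodup ∧ ∀ α, α ∈ lf) :
    ∃ b : Module.Basis (IndexPlus n d le lf) ℤ (integralSchur n d),
      ∀ p, (b p : schurAlgebra ℚ n d) = yPlus n d le lf p := by
  refine exists_basis_of_leading disjoint_posPairs_negPairs (fun p => ?_)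
    (fun p => (p.1.1, joinExponents p.1.2.1 p.1.2.2)) ?_ ?_ (yPlus n d le lf)
    (fun p => dividedPowerSubring_le (yPlus_mem le lf p))
    (fun p => toWordMatrix n d (KostantMonomial.eval d (eMonomial le p.1.2.1)))
    (fun p => toWordMatrix n d (KostantMonomial.eval d (fMonomial lf p.1.2.2)))
    (fun p => leading_eMonomial hle _ _) (fun p => leading_fMonomial hlf _ _) (fun p => ?_)
  · rw [Finset.mem_union, mem_posPairs, mem_negPairs, ne_iff_lt_or_gt]
  · rintro ⟨⟨l, A, C⟩, _⟩ ⟨⟨l', A', C'⟩, _⟩ h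
    obtain ⟨h1, h2⟩ := Prod.ext_iff.1 h
    obtain ⟨h3, h4⟩ := joinExponents_injective h2
    simp only at h1 h3 h4
    subst h1 h3 h4
    rfl
  · ext ⟨l, m⟩
    constructor
    · rintro ⟨p, hp⟩
      obtain ⟨h1, h2⟩ := Prod.ext_iff.1 hp
      simp only at h1 h2
      subst h1 h2
      refine ⟨fun a => joinExponents_diag _ _ a, fun a => ?_⟩
      rw [← content_apply hle hlf]
      exact p.2 a
    · rintro ⟨h0, hm⟩
      refine ⟨⟨(l, fun α => m α.1, fun α => m (α.1.2, α.1.1)), fun a => ?_⟩,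
        Prod.ext rfl (joinExponents_restrict h0)⟩
      rw [content_apply hle hlf, joinExponents_restrict h0]
      exact hm a
  · rw [yPlus, eval_append, eval_append, map_mul, map_mul, toWordMatrix_idemMonomial]

theorem exists_basis_yMinus {le lf : List (PosRoot n)} (hle : le.Nodup ∧ ∀ α, α ∈ le)
    (hlf : lf.Nodup ∧ ∀ α, α ∈ lf) :
    ∃ b : Module.Basis (IndexMinus n d le lf) ℤ (integralSchur n d),
      ∀ p, (b p : schurAlgebra ℚ n d) = yMinus n d le lf p := by
  refine exists_basis_of_leading disjoint_posPairs_negPairs.symm (fun p => ?_)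
    (fun p => (p.1.1, joinExponents p.1.2.2 p.1.2.1)) ?_ ?_ (yMinus n d le lf)
    (fun p => dividedPowerSubring_le (yMinus_mem le lf p))
    (fun p => toWordMatrix n d (KostantMonomial.eval d (fMonomial lf p.1.2.1)))
    (fun p => toWordMatrix n d (KostantMonomial.eval d (eMonomial le p.1.2.2)))
    (fun p => leading_fMonomial hlf _ _) (fun p => leading_eMonomial hle _ _) (fun p => ?_)
  · rw [Finset.mem_union, mem_posPairs, mem_negPairs, ne_iff_lt_or_gt, or_comm]
  · rintro ⟨⟨l, A, C⟩, _⟩ ⟨⟨l', A', C'⟩, _⟩ h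
    obtain ⟨h1, h2⟩ := Prod.ext_iff.1 h
    obtain ⟨h3, h4⟩ := joinExponents_injective h2
    simp only at h1 h3 h4
    subst h1 h3 h4
    rfl
  · ext ⟨l, m⟩
    constructor
    · rintro ⟨p, hp⟩
      obtain ⟨h1, h2⟩ := Prod.ext_iff.1 hp
      simp only at h1 h2
      subst h1 h2
      refine ⟨fun a => joinExponents_diag _ _ a, fun a => ?_⟩
      rw [← mirrorContent_apply hle hlf]
      exact p.2 a
    · rintro ⟨h0, hm⟩
      refine ⟨⟨(l, fun α => m (α.1.2, α.1.1), fun α => m α.1), fun a => ?_⟩,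
        Prod.ext rfl (joinExponents_restrict h0)⟩
      rw [mirrorContent_apply hle hlf, joinExponents_restrict h0]
      exact hm a
  · rw [yMinus, eval_append, eval_append, map_mul, map_mul, toWordMatrix_idemMonomial]

/-- The integral Schur algebra is spanned by `Y_+`, whose members are products of divided powers and
weight idempotents. -/
theorem integralSchur_eq_dividedPowerSubring {le lf : List (PosRoot n)}
    (hle : le.Nodup ∧ ∀ α, α ∈ le) (hlf : lf.Nodup ∧ ∀ α, α ∈ lf) :
    integralSchur n d = dividedPowerSubring n d := by
  refine le_antisymm (fun F hF => ?_) dividedPowerSubring_le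
  obtain ⟨b, hb⟩ := exists_basis_yPlus (d := d) hle hlf
  refine Submodule.span_induction (p := fun (x : integralSchur n d) _ =>
    (x : schurAlgebra ℚ n d) ∈ dividedPowerSubring n d) ?_ (zero_mem _)
    (fun x y _ _ hx hy => add_mem hx hy) (fun c x _ hx => zsmul_mem hx c) (b.mem_span ⟨F, hF⟩)
  rintro _ ⟨p, rfl⟩
  rw [hb]
  exact yPlus_mem le lf p

end SchurAlg

end

theorem mainTheorem2 (n d : ℕ) (le lf : List (SchurAlg.PosRoot n))
    (hle : le.Nodup ∧ ∀ α, α ∈ le) (hlf : lf.Nodup ∧ ∀ α, α ∈ lf) :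
    SchurAlg.integralSchur n d =
        Subring.closure
          {x | ∃ (i : Fin (n - 1)) (m : ℕ),
            x = SchurAlg.dividedPower (SchurAlg.e n d i) m ∨
            x = SchurAlg.dividedPower (SchurAlg.f n d i) m} ∧
      (∃ b : Module.Basis (SchurAlg.IndexPlus n d le lf) ℤ (SchurAlg.integralSchur n d),
        ∀ p, (b p : SchurAlg.schurAlgebra ℚ n d) = SchurAlg.yPlus n d le lf p) ∧
      (∃ b : Module.Basis (SchurAlg.IndexMinus n d le lf) ℤ (SchurAlg.integralSchur n d),
        ∀ p, (b p : SchurAlg.schurAlgebra ℚ n d) = SchurAlg.yMinus n d le lf p) :=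
  ⟨SchurAlg.integralSchur_eq_dividedPowerSubring hle hlf, SchurAlg.exists_basis_yPlus hle hlf,
    SchurAlg.exists_basis_yMinus hle hlf⟩
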